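/- Let $n\ge 2$ be an integer, write $B_r=\{x\in\mathbb R^n:|x|<r\}$, and let $f\in C^1(\mathbb R)$. A function $u\in W^{1,1}_{\rm loc}(B_2)$ is called a stable solution of $$\operatorname{div}\left(\frac{\nabla u}{\sqrt{1+|\nabla u|^2}}\right)=-f(u)\quad\text{in } B_2$$ if $f(u),f'(u)\in L^1_{\rm loc}(B_2)$, the equation holds weakly, i.e. $$\int_{B_2}\frac{\nabla u\cdot\nabla\varphi}{\sqrt{1+|\nabla u|^2}}\,dx=\int_{B_2}f(u)\varphi\,dx\qquad\text{for all }\varphi\in C_c^\infty(B_2),$$ and $$\int_{B_2}f'(u)\xi^2\,dx\le\int_{B_2}\left(\frac{|\nabla\xi|^2}{\sqrt{1+|\nabla u|^2}}-\frac{(\nabla u\cdot\nabla\xi)^2}{(1+|\nabla u|^2)^{3/2}}\right)dx\qquad\text{for all }\xi\in C_c^\infty(B_2).$$ Proposition. For every $n\ge2$ and every $\alpha\in(0,1)$ there is a constant $K=K(n,\alpha)>0$, depending only on $n$ and $\alpha$, such that the following holds: for every $f\in C^1(\mathbb R)$ and every stable solution $u\in W^{3,1}_{\rm loc}(B_2)$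 of this equation in $B_2$ that is radially symmetric with respect to the origin, $$\int_{B_\rho}|\nabla u|\,dx\le K\rho^{\,n-1+\alpha}\qquad\text{for all }0<\rho<1.$$ -/

import Mathlib

open MeasureTheory
open scoped ContDiff

namespace MeanCurvature

/-- `φ ∈ C_c^∞(Ω)`. -/
structure IsTestFunction {n : ℕ} (Ω : Set (EuclideanSpace ℝ (Fin n)))
    (φ : EuclideanSpace ℝ (Fin n) → ℝ) : Prop where
  smooth : ContDiff ℝ ∞ φ
  compact : HasCompactSupport φ
  subset : tsupport φ ⊆ Ω

/-- `u ∈ W^{1,1}_loc(Ω)` and `Du` is (a representative of) its weak gradient in `Ω`. -/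
structure HasWeakGradient {n : ℕ} (Ω : Set (EuclideanSpace ℝ (Fin n)))
    (u : EuclideanSpace ℝ (Fin n) → ℝ)
    (Du : EuclideanSpace ℝ (Fin n) → EuclideanSpace ℝ (Fin n)) : Prop where
  locInt : LocallyIntegrableOn u Ω volume
  locInt_grad : LocallyIntegrableOn Du Ω volume
  integral_eq : ∀ φ : EuclideanSpace ℝ (Fin n) → ℝ, IsTestFunction Ω φ → ∀ i : Fin n,
    ∫ x in Ω, u x * gradient φ x i = -∫ x in Ω, Du x i * φ x

/-- `u ∈ W^{k,1}_loc(Ω)`: all weak partial derivatives of `u` of order at most `k` exist and are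
locally integrable in `Ω`. -/
def MemSobolevLoc {n : ℕ} (Ω : Set (EuclideanSpace ℝ (Fin n))) :
    ℕ → (EuclideanSpace ℝ (Fin n) → ℝ) → Prop
  | 0, u => LocallyIntegrableOn u Ω volume
  | k + 1, u => ∃ Du : EuclideanSpace ℝ (Fin n) → EuclideanSpace ℝ (Fin n),
      HasWeakGradient Ω u Du ∧ ∀ i : Fin n, MemSobolevLoc Ω k (fun x => Du x i)

/-- `u`, with weak gradient `Du`, is a weak solution of
`div (∇u / √(1 + |∇u|²)) = -f(u)` in `Ω`. -/
structure IsWeakSolution {n : ℕ} (f : ℝ → ℝ) (Ω : Set (EuclideanSpace ℝ (Fin n)))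
    (u : EuclideanSpace ℝ (Fin n) → ℝ)
    (Du : EuclideanSpace ℝ (Fin n) → EuclideanSpace ℝ (Fin n)) : Prop where
  weakGradient : HasWeakGradient Ω u Du
  locInt_f : LocallyIntegrableOn (fun x => f (u x)) Ω volume
  equation : ∀ φ : EuclideanSpace ℝ (Fin n) → ℝ, IsTestFunction Ω φ →
    ∫ x in Ω, inner ℝ (Du x) (gradient φ x) / √(1 + ‖Du x‖ ^ 2) = ∫ x in Ω, f (u x) * φ x

/-- `u`, with weak gradient `Du`, is a stable solution of
`div (∇u / √(1 + |∇u|²)) = -f(u)` in `Ω`. -/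
structure IsStableSolution {n : ℕ} (f : ℝ → ℝ) (Ω : Set (EuclideanSpace ℝ (Fin n)))
    (u : EuclideanSpace ℝ (Fin n) → ℝ)
    (Du : EuclideanSpace ℝ (Fin n) → EuclideanSpace ℝ (Fin n)) : Prop
    extends IsWeakSolution f Ω u Du where
  locInt_deriv : LocallyIntegrableOn (fun x => deriv f (u x)) Ω volume
  stable : ∀ ξ : EuclideanSpace ℝ (Fin n) → ℝ, IsTestFunction Ω ξ →
    ∫ x in Ω, deriv f (u x) * ξ x ^ 2 ≤
      ∫ x in Ω, (‖gradient ξ x‖ ^ 2 / √(1 + ‖Du x‖ ^ 2)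
        - inner ℝ (Du x) (gradient ξ x) ^ 2 / (1 + ‖Du x‖ ^ 2) ^ (3 / 2 : ℝ))

/-- `u` is (almost everywhere equal to) a function of `|x|` in `Ω`. -/
def IsRadialOn {n : ℕ} (Ω : Set (EuclideanSpace ℝ (Fin n)))
    (u : EuclideanSpace ℝ (Fin n) → ℝ) : Prop :=
  ∃ g : ℝ → ℝ, ∀ᵐ x ∂(volume.restrict Ω), u x = g ‖x‖

end MeanCurvature

/-!
In annuli around the origin a radial function `u(x) = G(|x|)` of class `W^{2,1}` has a `C^1` profile
`G`: testing the second weak derivatives with the fields `χ(|x|) xᵢ xⱼ` produces a weak derivative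
of `G'` in one variable. Write `v = G'`, `m = n - 1` and `φ(v) = v / √(1 + v²)`. The equation
becomes `(r^m φ(v))' = -r^m f(G)`, and differentiating it once more gives
`(r^m φ'(v) v')' + r^m f'(G) v = m r^{m-2} φ(v)`, so that `v` solves the linearised equation up to a
term of a good sign. Testing the stability inequality with `ξ = v η` therefore yields
`m ∫ r^{m-2} φ(v) v η² ≤ ∫ r^m φ'(v) v² η'²`. Since `φ'(v) v² ≤ 1`, taking for `η` a truncation of
`r^{-β}` with `β = (m - 2 + α) / 2` bounds the right-hand side by a multiple of `∫₀² r^{-α} dr`,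
whatever `f`, `u` and the truncation radius are. Finally `|v| ≤ 1 + 2 φ(v) v` turns this into the
bound for `∫ |∇u|` over annuli, whose inner radius tends to zero.
-/

namespace MeanCurvature

open Set Filter Topology

theorem integrable_mul_of_tsupport_subset {X : Type*} [TopologicalSpace X] [T2Space X]
    [MeasurableSpace X] [OpensMeasurableSpace X] {μ : Measure X} {U : Set X} {g χ : X → ℝ}
    (hg : LocallyIntegrableOn g U μ) (hχ : Continuous χ) (hc : HasCompactSupport χ)
    (hU : tsupport χ ⊆ U) : Integrable (fun x => g x * χ x) μ :=
  (integrableOn_iff_integrable_of_support_subset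
    ((Function.support_mul_subset_right g χ).trans (subset_tsupport χ))).1
    ((hg.integrableOn_compact_subset hU hc).mul_continuousOn hχ.continuousOn hc)

theorem contDiff_of_tsupport {E : Type*} [NormedAddCommGroup E] [NormedSpace ℝ E] {g : E → ℝ}
    {k : WithTop ℕ∞} (hg : ∀ x ∈ tsupport g, ContDiffAt ℝ k g x) : ContDiff ℝ k g :=
  (contMDiff_of_tsupport fun x hx => (hg x hx).contMDiffAt).contDiff

theorem hasDerivAt_integral_right {F : ℝ → ℝ} (hF : Continuous F) (a r : ℝ) :
    HasDerivAt (fun r => ∫ s in a..r, F s) (F r) r :=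
  intervalIntegral.integral_hasDerivAt_right (hF.intervalIntegrable _ _)
    (hF.stronglyMeasurableAtFilter _ _) hF.continuousAt

/-- `χ ∈ C_c^∞(U)` for a set `U` of real numbers. -/
structure IsTestOn (U : Set ℝ) (χ : ℝ → ℝ) : Prop where
  smooth : ContDiff ℝ ∞ χ
  hasCompactSupport : HasCompactSupport χ
  tsupport_subset : tsupport χ ⊆ U

namespace IsTestOn

variable {U : Set ℝ} {a b : ℝ} {χ ψ : ℝ → ℝ}

theorem continuous (h : IsTestOn U χ) : Continuous χ := h.smooth.continuous

theorem hasDerivAt (h : IsTestOn U χ) (x : ℝ) : HasDerivAt χ (deriv χ x) x :=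
  (h.smooth.differentiable (by simp) x).hasDerivAt

theorem eq_zero (h : IsTestOn U χ) {x : ℝ} (hx : x ∉ U) : χ x = 0 :=
  image_eq_zero_of_notMem_tsupport fun hx' => hx (h.tsupport_subset hx')

protected theorem deriv (h : IsTestOn U χ) : IsTestOn U (deriv χ) where
  smooth := (contDiff_infty_iff_deriv.1 h.smooth).2
  hasCompactSupport := h.hasCompactSupport.deriv
  tsupport_subset := tsupport_deriv_subset.trans h.tsupport_subset

theorem mul_left (h : IsTestOn U χ) {p : ℝ → ℝ} (hp : ∀ x ∈ U, ContDiffAt ℝ ∞ p x) :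
    IsTestOn U (fun x => p x * χ x) where
  smooth := contDiff_of_tsupport fun x hx => (hp x (h.tsupport_subset
    (tsupport_mul_subset_right hx))).mul h.smooth.contDiffAt
  hasCompactSupport := h.hasCompactSupport.mul_left
  tsupport_subset := tsupport_mul_subset_right.trans h.tsupport_subset

theorem const_mul (h : IsTestOn U χ) (k : ℝ) : IsTestOn U (fun x => k * χ x) :=
  h.mul_left fun _ _ => contDiffAt_const

theorem add (h : IsTestOn U χ) (h' : IsTestOn U ψ) : IsTestOn U (fun x => χ x + ψ x) where
  smooth := h.smooth.add h'.smooth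
  hasCompactSupport := h.hasCompactSupport.add h'.hasCompactSupport
  tsupport_subset := (tsupport_add _ _).trans (union_subset h.tsupport_subset h'.tsupport_subset)

theorem sub (h : IsTestOn U χ) (h' : IsTestOn U ψ) : IsTestOn U (fun x => χ x - ψ x) := by
  simpa [sub_eq_add_neg] using h.add (h'.const_mul (-1))

theorem integrable (h : IsTestOn U χ) : Integrable χ :=
  h.continuous.integrable_of_hasCompactSupport h.hasCompactSupport

theorem integrable_mul (h : IsTestOn U χ) {g : ℝ → ℝ} (hg : LocallyIntegrableOn g U) :
    Integrable (fun x => g x * χ x) :=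
  integrable_mul_of_tsupport_subset hg h.continuous h.hasCompactSupport h.tsupport_subset

theorem exists_Icc (h : IsTestOn (Ioo a b) χ) :
    ∃ c d, a < c ∧ d < b ∧ tsupport χ ⊆ Icc c d := by
  rcases (tsupport χ).eq_empty_or_nonempty with h' | h'
  · exact ⟨a + 1, b - 1, by linarith, by linarith, by simp [h']⟩
  · obtain ⟨c, hc, hc_le⟩ := h.hasCompactSupport.isCompact.exists_isLeast h'
    obtain ⟨d, hd, hd_le⟩ := h.hasCompactSupport.isCompact.exists_isGreatest h'
    exact ⟨c, d, (h.tsupport_subset hc).1, (h.tsupport_subset hd).2,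
      fun x hx => ⟨hc_le hx, hd_le hx⟩⟩

theorem exists_deriv_eq (h : IsTestOn (Ioo a b) χ) (h0 : ∫ x, χ x = 0) :
    ∃ ψ, IsTestOn (Ioo a b) ψ ∧ deriv ψ = χ := by
  obtain ⟨c, d, hc, hd, hcd⟩ := h.exists_Icc
  have hderiv : deriv (fun x => ∫ t in c..x, χ t) = χ :=
    funext fun x => (hasDerivAt_integral_right h.continuous c x).deriv
  have hzero : ∀ t ∉ Icc c d, χ t = 0 := fun t ht =>
    image_eq_zero_of_notMem_tsupport fun ht' => ht (hcd ht')
  have hsupp : ∀ x ∉ Icc c d, ∫ t in c..x, χ t = 0 := by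
    intro x hx
    rcases lt_or_ge x c with hxc | hcx
    · rw [intervalIntegral.integral_symm, intervalIntegral.integral_of_le hxc.le,
        integral_Ioc_eq_integral_Ioo, setIntegral_eq_zero_of_forall_eq_zero, neg_zero]
      exact fun t ht => hzero t fun ht' => ht.2.not_ge ht'.1
    · have hdx : d < x := not_le.1 fun hxd => hx ⟨hcx, hxd⟩
      rw [intervalIntegral.integral_of_le hcx, ← integral_Icc_eq_integral_Ioc,
        setIntegral_eq_integral_of_forall_compl_eq_zero, h0]
      exact fun t ht => hzero t fun ht' => ht ⟨ht'.1, ht'.2.trans hdx.le⟩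
  have htsupp : tsupport (fun x => ∫ t in c..x, χ t) ⊆ Icc c d :=
    closure_minimal (fun x hx => by_contra fun hx' => hx (hsupp x hx')) isClosed_Icc
  refine ⟨fun x => ∫ t in c..x, χ t, ⟨?_, HasCompactSupport.intro isCompact_Icc hsupp,
    htsupp.trans fun x hx => ⟨hc.trans_le hx.1, hx.2.trans_lt hd⟩⟩, hderiv⟩
  exact contDiff_infty_iff_deriv.2 ⟨fun x =>
    (hasDerivAt_integral_right h.continuous c x).differentiableAt, by rw [hderiv]; exact h.smooth⟩

theorem exists_deriv_eq_sub {θ : ℝ → ℝ} (h : IsTestOn (Ioo a b) χ) (hθ : IsTestOn (Ioo a b) θ)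
    (hθ1 : ∫ x, θ x = 1) :
    ∃ ψ, IsTestOn (Ioo a b) ψ ∧ deriv ψ = fun x => χ x - (∫ t, χ t) * θ x :=
  (h.sub (hθ.const_mul _)).exists_deriv_eq <| by
    rw [integral_sub h.integrable (hθ.const_mul _).integrable, integral_const_mul, hθ1,
      mul_one, sub_self]

theorem integral_id_mul_deriv (h : IsTestOn U χ) : ∫ x, x * deriv χ x = -∫ x, χ x := by
  have := integral_mul_deriv_eq_deriv_mul_of_integrable (u := id) (u' := fun _ => 1)
    (fun x _ => hasDerivAt_id x) (fun x _ => h.hasDerivAt x)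
    (h.deriv.mul_left fun _ _ => contDiffAt_id).integrable
    (by simpa [Pi.mul_def] using h.integrable)
    (h.mul_left fun _ _ => contDiffAt_id).integrable
  simpa using this

end IsTestOn

theorem exists_isTestOn_integral_eq_one {a b : ℝ} (hab : a < b) :
    ∃ θ, IsTestOn (Ioo a b) θ ∧ ∫ x, θ x = 1 := by
  let φ : ContDiffBump ((a + b) / 2) := ⟨(b - a) / 8, (b - a) / 4, by linarith, by linarith⟩
  refine ⟨φ.normed volume, ⟨φ.contDiff_normed, φ.hasCompactSupport_normed, ?_⟩, φ.integral_normed⟩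
  rw [φ.tsupport_normed_eq, Real.closedBall_eq_Icc]
  exact Icc_subset_Ioo (by dsimp only [φ]; linarith) (by dsimp only [φ]; linarith)

theorem ae_eq_zero_of_forall_isTestOn {U : Set ℝ} (hU : IsOpen U) {h : ℝ → ℝ}
    (hh : LocallyIntegrableOn h U) (H : ∀ χ, IsTestOn U χ → ∫ x, h x * χ x = 0) :
    ∀ᵐ x, x ∈ U → h x = 0 :=
  hU.ae_eq_zero_of_integral_contDiff_smul_eq_zero hh fun χ hχ hc hs => by
    simpa only [smul_eq_mul, mul_comm] using H χ ⟨hχ, hc, hs⟩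

theorem ae_eq_const_of_integral_mul_deriv_eq_zero {a b : ℝ} (hab : a < b) {h : ℝ → ℝ}
    (hh : LocallyIntegrableOn h (Ioo a b))
    (H : ∀ χ, IsTestOn (Ioo a b) χ → ∫ x, h x * deriv χ x = 0) :
    ∃ c, ∀ᵐ x, x ∈ Ioo a b → h x = c := by
  obtain ⟨θ, hθ, hθ1⟩ := exists_isTestOn_integral_eq_one hab
  set c := ∫ x, h x * θ x
  have hc : ∀ χ, IsTestOn (Ioo a b) χ → ∫ x, (h x - c) * χ x = 0 := by
    intro χ hχ
    obtain ⟨ψ, hψ, hψχ⟩ := hχ.exists_deriv_eq_sub hθ hθ1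
    have hψ0 := H ψ hψ
    simp only [hψχ, mul_sub, mul_left_comm _ (∫ t, χ t)] at hψ0
    rw [integral_sub (hχ.integrable_mul hh) ((hθ.integrable_mul hh).const_mul _),
      integral_const_mul] at hψ0
    simp only [sub_mul]
    rw [integral_sub (hχ.integrable_mul hh) (hχ.integrable.const_mul _), integral_const_mul,
      mul_comm c, hψ0]
  refine ⟨c, (ae_eq_zero_of_forall_isTestOn isOpen_Ioo
    (hh.sub (locallyIntegrableOn_const c)) hc).mono fun x hx hx' => sub_eq_zero.1 (hx hx')⟩

theorem ae_eq_affine_of_integral_mul_deriv_deriv_eq_zero {a b : ℝ} (hab : a < b) {h : ℝ → ℝ}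
    (hh : LocallyIntegrableOn h (Ioo a b))
    (H : ∀ χ, IsTestOn (Ioo a b) χ → ∫ x, h x * deriv (deriv χ) x = 0) :
    ∃ c e, ∀ᵐ x, x ∈ Ioo a b → h x = c + e * x := by
  obtain ⟨θ, hθ, hθ1⟩ := exists_isTestOn_integral_eq_one hab
  set e := -∫ x, h x * deriv θ x
  have hlin : LocallyIntegrableOn (fun x => e * x) (Ioo a b) :=
    (continuous_const.mul continuous_id).locallyIntegrable.locallyIntegrableOn _
  have hconst : ∀ χ, IsTestOn (Ioo a b) χ → ∫ x, (h x - e * x) * deriv χ x = 0 := by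
    intro χ hχ
    obtain ⟨ψ, hψ, hψχ⟩ := hχ.exists_deriv_eq_sub hθ hθ1
    have hψ0 := H ψ hψ
    have hderiv : deriv (deriv ψ) = fun x => deriv χ x - (∫ t, χ t) * deriv θ x :=
      hψχ ▸ funext fun x => ((hχ.hasDerivAt x).sub ((hθ.hasDerivAt x).const_mul _)).deriv
    simp only [hderiv, mul_sub, mul_left_comm _ (∫ t, χ t)] at hψ0
    rw [integral_sub (hχ.deriv.integrable_mul hh) ((hθ.deriv.integrable_mul hh).const_mul _),
      integral_const_mul] at hψ0
    simp only [sub_mul]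
    rw [integral_sub (hχ.deriv.integrable_mul hh) (hχ.deriv.integrable_mul hlin)]
    simp only [mul_assoc]
    rw [integral_const_mul, hχ.integral_id_mul_deriv]
    linarith
  obtain ⟨c, hc⟩ := ae_eq_const_of_integral_mul_deriv_eq_zero hab (hh.sub hlin) hconst
  exact ⟨c, e, hc.mono fun x hx hx' => sub_eq_iff_eq_add.1 (hx hx')⟩

theorem exists_isTestOn_dist_le {U : Set ℝ} (hU : IsOpen U) {w : ℝ → ℝ} (hw : ContDiff ℝ 1 w)
    (hc : HasCompactSupport w) (hwU : tsupport w ⊆ U) {ε : ℝ} (hε : 0 < ε) :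
    ∃ χ, IsTestOn U χ ∧ ∀ x, dist (χ x) (w x) ≤ ε ∧ dist (deriv χ x) (deriv w x) ≤ ε := by
  have hw' : Continuous (deriv w) := hw.continuous_deriv le_rfl
  obtain ⟨δ₀, hδ₀, hδ₀U⟩ := hc.isCompact.exists_cthickening_subset_open hU hwU
  obtain ⟨δ₁, hδ₁, hδ₁w⟩ := Metric.uniformContinuous_iff.1
    (hc.uniformContinuous_of_continuous hw.continuous) ε hε
  obtain ⟨δ₂, hδ₂, hδ₂w⟩ := Metric.uniformContinuous_iff.1
    (hc.deriv.uniformContinuous_of_continuous hw') ε hε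
  have hδ : 0 < min δ₀ (min δ₁ δ₂) := lt_min hδ₀ (lt_min hδ₁ hδ₂)
  let φ : ContDiffBump (0 : ℝ) := ⟨_, _, half_pos hδ, half_lt_self hδ⟩
  have hφδ₁ : φ.rOut ≤ δ₁ := (min_le_right _ _).trans (min_le_left _ _)
  have hφδ₂ : φ.rOut ≤ δ₂ := (min_le_right _ _).trans (min_le_right _ _)
  let L := ContinuousLinearMap.lsmul ℝ ℝ (E := ℝ)
  have hderiv : deriv (convolution (φ.normed volume) w L volume) =
      convolution (φ.normed volume) (deriv w) L volume :=
    funext fun x => (hc.hasDerivAt_convolution_right L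
      φ.continuous_normed.locallyIntegrable hw x).deriv
  have hsupp : Function.support (convolution (φ.normed volume) w L volume) ⊆
      Metric.thickening φ.rOut (tsupport w) := by
    intro x hx
    obtain ⟨y, hy, z, hz, rfl⟩ := support_convolution_subset L hx
    rw [φ.support_normed_eq, mem_ball_zero_iff] at hy
    exact Metric.mem_thickening_iff.2 ⟨z, subset_tsupport w hz, by simpa [dist_eq_norm] using hy⟩
  refine ⟨convolution (φ.normed volume) w L volume, ⟨?_, ?_, ?_⟩, fun x => ⟨?_, ?_⟩⟩
  · exact φ.hasCompactSupport_normed.contDiff_convolution_left L φ.contDiff_normed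
      hw.continuous.locallyIntegrable
  · exact φ.hasCompactSupport_normed.convolution L hc
  · exact (closure_minimal (hsupp.trans (Metric.thickening_subset_cthickening _ _))
      Metric.isClosed_cthickening).trans
        ((Metric.cthickening_mono (min_le_left _ _) _).trans hδ₀U)
  · exact φ.dist_normed_convolution_le hw.continuous.aestronglyMeasurable fun y hy =>
      (hδ₁w ((Metric.mem_ball.1 hy).trans_le hφδ₁)).le
  · rw [hderiv]
    exact φ.dist_normed_convolution_le hw'.aestronglyMeasurable fun y hy =>
      (hδ₂w ((Metric.mem_ball.1 hy).trans_le hφδ₂)).le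

theorem tendsto_integral_mul_sq {X : Type*} [MeasurableSpace X] {μ : Measure X} {p w : X → ℝ}
    {g : ℕ → X → ℝ} {M : ℝ} (hp : Integrable p μ) (hg : ∀ k, AEStronglyMeasurable (g k) μ)
    (hgw : ∀ k x, dist (g k x) (w x) ≤ 1 / ((k : ℝ) + 1)) (hM : ∀ x, ‖w x‖ ≤ M) :
    Tendsto (fun k => ∫ x, p x * g k x ^ 2 ∂μ) atTop (𝓝 (∫ x, p x * w x ^ 2 ∂μ)) := by
  have hlim : ∀ x, Tendsto (g · x) atTop (𝓝 (w x)) := fun x =>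
    tendsto_iff_dist_tendsto_zero.2 <| squeeze_zero (fun _ => dist_nonneg) (fun k => hgw k x)
      tendsto_one_div_add_atTop_nhds_zero_nat
  have hbound : ∀ k x, ‖g k x‖ ≤ 1 + M := fun k x => by
    have h := hgw k x
    rw [dist_eq_norm] at h
    have hk : 1 / ((k : ℝ) + 1) ≤ 1 :=
      div_le_one_of_le₀ (by linarith [k.cast_nonneg (α := ℝ)]) (by positivity)
    linarith [norm_le_norm_sub_add (g k x) (w x), hM x]
  refine tendsto_integral_of_dominated_convergence (fun x => ‖p x‖ * (1 + M) ^ 2)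
    (fun k => hp.aestronglyMeasurable.mul ((hg k).pow 2)) (hp.norm.mul_const _)
    (fun k => ae_of_all _ fun x => ?_) (ae_of_all _ fun x => ((hlim x).pow 2).const_mul _)
  rw [norm_mul, norm_pow]
  gcongr
  exact hbound k x

theorem integral_mul_sq_le_of_forall_isTestOn {U : Set ℝ} (hU : IsOpen U) {p q : ℝ → ℝ}
    (hp : IntegrableOn p U) (hq : IntegrableOn q U)
    (H : ∀ χ, IsTestOn U χ → ∫ x, p x * χ x ^ 2 ≤ ∫ x, q x * deriv χ x ^ 2)
    {w : ℝ → ℝ} (hw : ContDiff ℝ 1 w) (hc : HasCompactSupport w) (hwU : tsupport w ⊆ U) :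
    ∫ x, p x * w x ^ 2 ≤ ∫ x, q x * deriv w x ^ 2 := by
  have hset : ∀ s v : ℝ → ℝ, tsupport v ⊆ U → ∫ x in U, s x * v x ^ 2 = ∫ x, s x * v x ^ 2 := by
    refine fun s v hv => setIntegral_eq_integral_of_forall_compl_eq_zero fun x hx => ?_
    rw [image_eq_zero_of_notMem_tsupport fun hx' => hx (hv hx'), zero_pow two_ne_zero, mul_zero]
  choose χ hχ hχw using fun k : ℕ =>
    exists_isTestOn_dist_le hU hw hc hwU (Nat.one_div_pos_of_nat (α := ℝ) (n := k))
  obtain ⟨M, hM⟩ := hc.exists_bound_of_continuous hw.continuous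
  obtain ⟨M', hM'⟩ := hc.deriv.exists_bound_of_continuous (hw.continuous_deriv le_rfl)
  have hlim := tendsto_integral_mul_sq hp (fun k => (hχ k).continuous.aestronglyMeasurable)
    (fun k x => (hχw k x).1) hM
  have hlim' := tendsto_integral_mul_sq hq (fun k => (hχ k).deriv.continuous.aestronglyMeasurable)
    (fun k x => (hχw k x).2) hM'
  rw [hset p w hwU] at hlim
  rw [hset q (deriv w) (tsupport_deriv_subset.trans hwU)] at hlim'
  refine le_of_tendsto_of_tendsto' hlim hlim' fun k => ?_
  rw [hset p _ (hχ k).tsupport_subset, hset q _ (hχ k).deriv.tsupport_subset]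
  exact H _ (hχ k)

theorem gradient_apply {n : ℕ} (φ : EuclideanSpace ℝ (Fin n) → ℝ) (x : EuclideanSpace ℝ (Fin n))
    (i : Fin n) : gradient φ x i = fderiv ℝ φ x (EuclideanSpace.single i 1) := by
  rw [← inner_gradient_left, EuclideanSpace.inner_single_right]
  simp

section WeakGradient

variable {n : ℕ} {Ω V : Set (EuclideanSpace ℝ (Fin n))} {u v φ : EuclideanSpace ℝ (Fin n) → ℝ}
  {Du Dv : EuclideanSpace ℝ (Fin n) → EuclideanSpace ℝ (Fin n)}

theorem IsTestFunction.mono (hφ : IsTestFunction V φ) (hV : V ⊆ Ω) : IsTestFunction Ω φ :=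
  ⟨hφ.smooth, hφ.compact, hφ.subset.trans hV⟩

theorem IsTestFunction.gradient_apply (hφ : IsTestFunction Ω φ) (i : Fin n) :
    IsTestFunction Ω (fun x => gradient φ x i) := by
  simp only [MeanCurvature.gradient_apply]
  exact ⟨(hφ.smooth.fderiv_right le_rfl).clm_apply contDiff_const, hφ.compact.fderiv_apply ℝ _,
    (tsupport_fderiv_apply_subset ℝ _).trans hφ.subset⟩

theorem IsTestFunction.integrable_mul (hφ : IsTestFunction Ω φ)
    (hu : LocallyIntegrableOn u Ω volume) : Integrable (fun x => u x * φ x) :=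
  integrable_mul_of_tsupport_subset hu hφ.smooth.continuous hφ.compact hφ.subset

theorem IsTestFunction.setIntegral_mul (hφ : IsTestFunction Ω φ) :
    ∫ x in Ω, u x * φ x = ∫ x, u x * φ x :=
  setIntegral_eq_integral_of_forall_compl_eq_zero fun x hx => by
    rw [image_eq_zero_of_notMem_tsupport fun hx' => hx (hφ.subset hx'), mul_zero]

theorem locallyIntegrableOn_coord (hDu : LocallyIntegrableOn Du Ω volume) (i : Fin n) :
    LocallyIntegrableOn (fun x => Du x i) Ω volume := fun x hx =>
  let ⟨s, hs, hint⟩ := hDu x hx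
  ⟨s, hs, (EuclideanSpace.proj i : EuclideanSpace ℝ (Fin n) →L[ℝ] ℝ).integrable_comp hint⟩

theorem HasWeakGradient.mono (h : HasWeakGradient Ω u Du) (hV : V ⊆ Ω) :
    HasWeakGradient V u Du where
  locInt := h.locInt.mono_set hV
  locInt_grad := h.locInt_grad.mono_set hV
  integral_eq φ hφ i := by
    have := h.integral_eq φ (hφ.mono hV) i
    rwa [((hφ.mono hV).gradient_apply i).setIntegral_mul, (hφ.mono hV).setIntegral_mul,
      ← (hφ.gradient_apply i).setIntegral_mul, ← hφ.setIntegral_mul] at this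

theorem HasWeakGradient.ae_eq (hV : IsOpen V) (hu : HasWeakGradient V u Du)
    (hv : HasWeakGradient V v Dv) (huv : u =ᵐ[volume.restrict V] v) :
    Du =ᵐ[volume.restrict V] Dv := by
  have hcoord : ∀ i, ∀ᵐ x, x ∈ V → Du x i - Dv x i = 0 := by
    intro i
    have hDu := locallyIntegrableOn_coord hu.locInt_grad i
    have hDv := locallyIntegrableOn_coord hv.locInt_grad i
    refine hV.ae_eq_zero_of_integral_contDiff_smul_eq_zero (hDu.sub hDv) fun φ hφ hc hs => ?_
    have hφ' : IsTestFunction V φ := ⟨hφ, hc, hs⟩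
    have heq : ∫ x in V, Du x i * φ x = ∫ x in V, Dv x i * φ x := by
      rw [← neg_inj, ← hu.integral_eq φ hφ' i, ← hv.integral_eq φ hφ' i]
      exact integral_congr_ae (huv.mono fun x hx => by simp only [hx])
    simp only [smul_eq_mul, mul_comm (φ _)]
    change ∫ x, (Du x i - Dv x i) * φ x = 0
    simp only [sub_mul]
    rw [integral_sub (hφ'.integrable_mul hDu) (hφ'.integrable_mul hDv), sub_eq_zero,
      ← hφ'.setIntegral_mul, ← hφ'.setIntegral_mul, heq]
  refine (ae_restrict_iff' hV.measurableSet).2 ?_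
  filter_upwards [ae_all_iff.2 hcoord] with x hx hxV
  ext i
  exact sub_eq_zero.1 (hx i hxV)

theorem hasWeakGradient_of_hasGradientAt (hV : IsOpen V)
    (hu : ∀ x ∈ V, HasGradientAt u (Du x) x) (hDu : ContinuousOn Du V) :
    HasWeakGradient V u Du where
  locInt := (HasGradientAt.continuousOn hu).locallyIntegrableOn hV.measurableSet
  locInt_grad := hDu.locallyIntegrableOn hV.measurableSet
  integral_eq φ hφ i := by
    have hu_int := (HasGradientAt.continuousOn hu).locallyIntegrableOn (μ := volume)
      hV.measurableSet
    have hDu_int := locallyIntegrableOn_coord (hDu.locallyIntegrableOn (μ := volume)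
      hV.measurableSet) i
    have := integral_bilinear_hasFDerivAt_right_eq_neg_left_of_integrable (μ := volume)
      (f := u) (f' := fun x => InnerProductSpace.toDual ℝ _ (Du x)) (g := φ) (g' := fderiv ℝ φ)
      (v := EuclideanSpace.single i 1) (B := ContinuousLinearMap.mul ℝ ℝ)
      (by simpa [EuclideanSpace.inner_single_right] using hφ.integrable_mul hDu_int)
      (by simpa [gradient_apply] using (hφ.gradient_apply i).integrable_mul hu_int)
      (hφ.integrable_mul hu_int) (fun x hx => (hu x (hφ.subset hx)).hasFDerivAt)
      (fun x _ => (hφ.smooth.differentiable (by simp) x).hasFDerivAt)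
    rw [(hφ.gradient_apply i).setIntegral_mul, hφ.setIntegral_mul]
    simpa [gradient_apply, EuclideanSpace.inner_single_right] using this

theorem MemSobolevLoc.of_succ {k : ℕ} (hu : MemSobolevLoc Ω (k + 1) u) : MemSobolevLoc Ω k u := by
  induction k generalizing u with
  | zero => exact hu.choose_spec.1.locInt
  | succ k ih =>
    obtain ⟨Du, hDu, hDu_mem⟩ := hu
    exact ⟨Du, hDu, fun i => ih (hDu_mem i)⟩

end WeakGradient

section Radial

variable {E : Type*} [NormedAddCommGroup E] [InnerProductSpace ℝ E] {x : E} {U : Set ℝ}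
  {χ : ℝ → ℝ}

theorem hasFDerivAt_norm (hx : x ≠ 0) :
    HasFDerivAt (fun y : E => ‖y‖) (‖x‖⁻¹ • innerSL ℝ x) x := by
  have h := (hasStrictFDerivAt_norm_sq x).hasFDerivAt.sqrt (by simpa using hx)
  simp only [Real.sqrt_sq (norm_nonneg _)] at h
  convert h using 1
  rw [← Nat.cast_smul_eq_nsmul ℝ, smul_smul]
  congr 1
  have := norm_ne_zero_iff.2 hx
  field_simp
  norm_num

theorem hasGradientAt_comp_norm [CompleteSpace E] {G : ℝ → ℝ} {G' : ℝ} (hx : x ≠ 0)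
    (hG : HasDerivAt G G' ‖x‖) :
    HasGradientAt (fun y : E => G ‖y‖) ((G' * ‖x‖⁻¹) • x) x :=
  hasGradientAt_iff_hasFDerivAt.2 <|
    (hG.comp_hasFDerivAt x (hasFDerivAt_norm hx)).congr_fderiv <| by ext y; simp [mul_assoc]

theorem IsTestOn.hasGradientAt_comp_norm [CompleteSpace E] (h : IsTestOn U χ) (hU : 0 ∉ U)
    (x : E) : HasGradientAt (fun y : E => χ ‖y‖) ((deriv χ ‖x‖ * ‖x‖⁻¹) • x) x := by
  rcases eq_or_ne x 0 with rfl | hx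
  · have h0 : χ =ᶠ[𝓝 ‖(0 : E)‖] 0 :=
      notMem_tsupport_iff_eventuallyEq.1 fun hx => hU (h.tsupport_subset (by simpa using hx))
    simpa using (hasGradientAt_const (𝕜 := ℝ) (0 : E) (0 : ℝ)).congr_of_eventuallyEq
      (continuous_norm.continuousAt.eventually h0)
  · exact MeanCurvature.hasGradientAt_comp_norm hx (h.hasDerivAt _)

theorem IsTestOn.gradient_comp_norm [CompleteSpace E] (h : IsTestOn U χ) (hU : 0 ∉ U) (x : E) :
    gradient (fun y : E => χ ‖y‖) x = (deriv χ ‖x‖ * ‖x‖⁻¹) • x :=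
  (h.hasGradientAt_comp_norm hU x).gradient

theorem hasGradientAt_mul [CompleteSpace E] {p q : E → ℝ} {p' q' : E}
    (hp : HasGradientAt p p' x) (hq : HasGradientAt q q' x) :
    HasGradientAt (fun y => p y * q y) (p x • q' + q x • p') x :=
  hasGradientAt_iff_hasFDerivAt.2 <| (hp.hasFDerivAt.mul hq.hasFDerivAt).congr_fderiv (by simp)

end Radial

section RadialTest

variable {n : ℕ} {Ω : Set (EuclideanSpace ℝ (Fin n))} {U : Set ℝ} {χ : ℝ → ℝ}
  {p : EuclideanSpace ℝ (Fin n) → ℝ} {p' : EuclideanSpace ℝ (Fin n) → EuclideanSpace ℝ (Fin n)}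

theorem hasGradientAt_coord (i : Fin n) (x : EuclideanSpace ℝ (Fin n)) :
    HasGradientAt (fun y : EuclideanSpace ℝ (Fin n) => y i) (EuclideanSpace.single i 1) x :=
  hasGradientAt_iff_hasFDerivAt.2 <|
    (EuclideanSpace.proj i : EuclideanSpace ℝ (Fin n) →L[ℝ] ℝ).hasFDerivAt.congr_fderiv <| by
      ext y
      simp [EuclideanSpace.inner_single_left]

theorem contDiff_coord (i : Fin n) : ContDiff ℝ ∞ (fun y : EuclideanSpace ℝ (Fin n) => y i) :=
  (EuclideanSpace.proj i : EuclideanSpace ℝ (Fin n) →L[ℝ] ℝ).contDiff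

theorem IsTestOn.isTestFunction_mul (h : IsTestOn U χ) (hU : 0 ∉ U) (hΩ : norm ⁻¹' U ⊆ Ω)
    (hp : ContDiff ℝ ∞ p) : IsTestFunction Ω (fun x => χ ‖x‖ * p x) := by
  have hsupp : tsupport (fun x => χ ‖x‖ * p x) ⊆ norm ⁻¹' tsupport χ :=
    tsupport_mul_subset_left.trans (tsupport_comp_subset_preimage χ continuous_norm)
  refine ⟨contDiff_of_tsupport fun x hx => ?_, ?_,
    hsupp.trans ((preimage_mono h.tsupport_subset).trans hΩ)⟩
  · have hx0 : x ≠ 0 := by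
      rintro rfl
      exact hU (h.tsupport_subset (by simpa using hsupp hx))
    exact (h.smooth.contDiffAt.comp x (contDiffAt_norm ℝ hx0)).mul hp.contDiffAt
  · obtain ⟨C, hC⟩ := h.hasCompactSupport.isCompact.isBounded.subset_closedBall 0
    refine HasCompactSupport.of_support_subset_isCompact (isCompact_closedBall 0 C)
      ((subset_tsupport _).trans (hsupp.trans fun x hx => ?_))
    simpa using hC hx

theorem IsTestOn.isTestFunction (h : IsTestOn U χ) (hU : 0 ∉ U) (hΩ : norm ⁻¹' U ⊆ Ω) :
    IsTestFunction Ω (fun x => χ ‖x‖) := by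
  simpa using h.isTestFunction_mul hU hΩ (p := fun _ => 1) contDiff_const

theorem IsTestOn.sum_gradient_mul_coord (h : IsTestOn U χ) (hU : 0 ∉ U)
    {x : EuclideanSpace ℝ (Fin n)} {p' : EuclideanSpace ℝ (Fin n)} (hp : HasGradientAt p p' x) :
    ∑ i, gradient (fun y => χ ‖y‖ * (p y * y i)) x i
      = ‖x‖ * deriv χ ‖x‖ * p x + χ ‖x‖ * (n * p x + inner ℝ p' x) := by
  have hgrad : ∀ i, gradient (fun y => χ ‖y‖ * (p y * y i)) x i
      = χ ‖x‖ * (p x + x i * p' i) + p x * (deriv χ ‖x‖ * ‖x‖⁻¹) * (x i * x i) := fun i => by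
    rw [(hasGradientAt_mul (h.hasGradientAt_comp_norm hU x)
      (hasGradientAt_mul hp (hasGradientAt_coord i x))).gradient]
    simp only [smul_add, PiLp.add_apply, PiLp.smul_apply, PiLp.single_eq_same, smul_eq_mul,
      mul_one]
    ring
  have hnorm : ∑ i, x i * x i = ‖x‖ * ‖x‖ := by
    rw [← real_inner_self_eq_norm_mul_norm, PiLp.inner_apply]
    rfl
  simp only [hgrad, Finset.sum_add_distrib, ← Finset.mul_sum, hnorm, PiLp.inner_apply]
  rcases eq_or_ne ‖x‖ 0 with hx | hx
  · simp [hx]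
  · simp only [Finset.sum_const, Finset.card_univ, Fintype.card_fin, nsmul_eq_mul,
      RCLike.inner_apply, Real.ringHom_apply]
    field_simp
    ring

theorem HasWeakGradient.integral_radial {u : EuclideanSpace ℝ (Fin n) → ℝ}
    {Du : EuclideanSpace ℝ (Fin n) → EuclideanSpace ℝ (Fin n)} (hu : HasWeakGradient Ω u Du)
    (hχ : IsTestOn U χ) (hU : 0 ∉ U) (hΩ : norm ⁻¹' U ⊆ Ω) (hp : ContDiff ℝ ∞ p)
    (hp' : ∀ x, HasGradientAt p (p' x) x) :
    ∫ x, u x * (‖x‖ * deriv χ ‖x‖ * p x + χ ‖x‖ * (n * p x + inner ℝ (p' x) x))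
      = -∫ x, χ ‖x‖ * (p x * inner ℝ (Du x) x) := by
  have htest : ∀ i : Fin n, IsTestFunction Ω (fun x => χ ‖x‖ * (p x * x i)) :=
    fun i => hχ.isTestFunction_mul hU hΩ (hp.mul (contDiff_coord i))
  calc ∫ x, u x * (‖x‖ * deriv χ ‖x‖ * p x + χ ‖x‖ * (n * p x + inner ℝ (p' x) x))
    _ = ∑ i, ∫ x, u x * gradient (fun y => χ ‖y‖ * (p y * y i)) x i := by
      simp only [← hχ.sum_gradient_mul_coord hU (hp' _), Finset.mul_sum]
      exact integral_finsetSum _ fun i _ => ((htest i).gradient_apply i).integrable_mul hu.locInt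
    _ = -∑ i, ∫ x, Du x i * (χ ‖x‖ * (p x * x i)) := by
      rw [← Finset.sum_neg_distrib]
      refine Finset.sum_congr rfl fun i _ => ?_
      rw [← ((htest i).gradient_apply i).setIntegral_mul, ← (htest i).setIntegral_mul]
      exact hu.integral_eq _ (htest i) i
    _ = _ := by
      rw [← integral_finsetSum _ fun i _ =>
        (htest i).integrable_mul (locallyIntegrableOn_coord hu.locInt_grad i)]
      simp only [PiLp.inner_apply, Finset.mul_sum]
      simp [mul_left_comm, mul_comm, mul_assoc]

end RadialTest

section Polar

variable {E : Type*} [NormedAddCommGroup E] [NormedSpace ℝ E] [FiniteDimensional ℝ E]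
  [Nontrivial E] [MeasurableSpace E] [BorelSpace E] {μ : Measure E} [μ.IsAddHaarMeasure]
  {s : Set ℝ} {q : ℝ → ℝ}

open Module (finrank)

theorem toSphere_real_univ_pos : 0 < μ.toSphere.real univ :=
  have : NeZero μ.toSphere := ⟨μ.toSphere_ne_zero⟩
  measureReal_univ_pos

theorem integrableOn_comp_norm_iff (hs : MeasurableSet s) (hs0 : s ⊆ Ioi 0) :
    IntegrableOn (fun x : E => q ‖x‖) (norm ⁻¹' s) μ ↔
      IntegrableOn (fun r => r ^ (finrank ℝ E - 1) * q r) s := by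
  have h := integrable_fun_norm_addHaar μ (f := s.indicator q)
  have hind : (fun r => r ^ (finrank ℝ E - 1) • s.indicator q r) =
      s.indicator fun r => r ^ (finrank ℝ E - 1) * q r :=
    funext fun r => (indicator_mul_right s _ q).symm
  rw [hind, integrableOn_iff_integrable_of_support_subset
    (support_indicator_subset.trans hs0), integrable_indicator_iff hs] at h
  rw [← h, ← integrable_indicator_iff (measurable_norm hs)]
  rfl

theorem setIntegral_eq_of_ae_eq_comp_norm {F : E → ℝ} {Ω : Set E} (hs0 : s ⊆ Ioi 0)
    (hΩ : norm ⁻¹' s ⊆ Ω) (hq : ∀ r ∉ s, q r = 0) (hF : ∀ᵐ x ∂μ, F x = q ‖x‖) :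
    ∫ x in Ω, F x ∂μ = μ.toSphere.real univ * ∫ r, r ^ (finrank ℝ E - 1) * q r := by
  have hpolar := integral_fun_norm_addHaar μ q
  rw [nsmul_eq_mul, smul_eq_mul, ← mul_assoc, ← μ.toSphere_real_apply_univ,
    setIntegral_eq_integral_of_forall_compl_eq_zero
      fun r hr => by rw [hq r fun h => hr (hs0 h), smul_zero]] at hpolar
  rw [integral_congr_ae (ae_restrict_of_ae hF),
    setIntegral_eq_integral_of_forall_compl_eq_zero fun x hx => hq _ fun h => hx (hΩ h)]
  exact hpolar

theorem ae_comp_norm {p : ℝ → Prop} (hp : ∀ᵐ r, p r) : ∀ᵐ x ∂μ, p ‖x‖ := by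
  let q : ℝ → ℝ := indicator {r | ¬ p r} 1
  have hq : ∀ᵐ r, r ^ (finrank ℝ E - 1) • q r = 0 := by
    filter_upwards [hp] with r hr
    simp [q, hr]
  have hint : Integrable (fun x => q ‖x‖) μ := by
    refine (integrable_fun_norm_addHaar μ).2 ((integrable_zero ℝ ℝ _).congr ?_)
    filter_upwards [ae_restrict_of_ae hq] with r hr using hr.symm
  have hzero : ∫ x, q ‖x‖ ∂μ = 0 := by
    rw [integral_fun_norm_addHaar, integral_congr_ae (ae_restrict_of_ae hq)]
    simp
  rw [integral_eq_zero_iff_of_nonneg (fun x => indicator_nonneg (by simp) _) hint] at hzero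
  filter_upwards [hzero] with x hx
  by_contra h
  simp [h] at hx

end Polar

section SecondOrder

variable {n : ℕ} {Ω : Set (EuclideanSpace ℝ (Fin n))} {u : EuclideanSpace ℝ (Fin n) → ℝ}
  {Du : EuclideanSpace ℝ (Fin n) → EuclideanSpace ℝ (Fin n)}
  {D2u : Fin n → EuclideanSpace ℝ (Fin n) → EuclideanSpace ℝ (Fin n)} {U : Set ℝ} {χ κ : ℝ → ℝ}

theorem IsTestOn.euler (h : IsTestOn U χ) (k : ℝ) :
    IsTestOn U (fun r => r * _root_.deriv χ r + k * χ r) :=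
  (h.deriv.mul_left fun _ _ => contDiffAt_id).add (h.const_mul k)

theorem HasWeakGradient.integral_radial_radial (hu : HasWeakGradient Ω u Du)
    (hDu : ∀ i, HasWeakGradient Ω (fun x => Du x i) (D2u i)) (hU : 0 ∉ U)
    (hΩ : norm ⁻¹' U ⊆ Ω) (hχ : IsTestOn U χ) (hκ : ∀ r, κ r = r * deriv χ r + (n + 1) * χ r) :
    ∫ x, u x * (‖x‖ * deriv κ ‖x‖ + n * κ ‖x‖)
      = ∫ x, χ ‖x‖ * ∑ i, x i * inner ℝ (D2u i x) x := by
  obtain rfl : κ = _ := funext hκ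
  have hint (i : Fin n) : Integrable fun x => χ ‖x‖ * (x i * inner ℝ (D2u i x) x) := by
    simp only [PiLp.inner_apply, Finset.mul_sum]
    refine integrable_finsetSum _ fun j _ => ((hχ.isTestFunction_mul hU hΩ
      ((contDiff_coord i).mul (contDiff_coord j))).integrable_mul
        (locallyIntegrableOn_coord (hDu i).locInt_grad j)).congr (ae_of_all _ fun x => ?_)
    simp only [RCLike.inner_apply, conj_trivial]
    ring
  have htest (i : Fin n) : ∫ x, Du x i * ((‖x‖ * deriv χ ‖x‖ + (n + 1) * χ ‖x‖) * x i)
      = -∫ x, χ ‖x‖ * (x i * inner ℝ (D2u i x) x) := by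
    rw [← (hDu i).integral_radial hχ hU hΩ (contDiff_coord i) (hasGradientAt_coord i)]
    congr with x
    rw [EuclideanSpace.inner_single_left, map_one]
    ring
  have hfirst := hu.integral_radial (hχ.euler (n + 1)) hU hΩ (contDiff_const (c := 1))
    fun x => hasGradientAt_const x 1
  simp only [mul_one, inner_zero_left, add_zero, one_mul] at hfirst
  calc ∫ x, u x * (‖x‖ * deriv (fun r => r * deriv χ r + (n + 1) * χ r) ‖x‖
        + n * (‖x‖ * deriv χ ‖x‖ + (n + 1) * χ ‖x‖))
    _ = -∫ x, ∑ i, Du x i * ((‖x‖ * deriv χ ‖x‖ + (n + 1) * χ ‖x‖) * x i) := by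
      convert hfirst using 4 with x x
      · ring
      · simp only [PiLp.inner_apply, RCLike.inner_apply, conj_trivial, Finset.mul_sum]
        exact Finset.sum_congr rfl fun i _ => by ring
    _ = -∑ i, -∫ x, χ ‖x‖ * (x i * inner ℝ (D2u i x) x) := by
      rw [integral_finsetSum _ fun i _ => ((hχ.euler (n + 1)).isTestFunction_mul hU hΩ
        (contDiff_coord i)).integrable_mul (locallyIntegrableOn_coord hu.locInt_grad i)]
      simp only [htest]
    _ = _ := by
      simp only [Finset.sum_neg_distrib, neg_neg, Finset.mul_sum]
      exact (integral_finsetSum _ fun i _ => hint i).symm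

end SecondOrder

section SublevelSets

variable {X : Type*} [MeasurableSpace X] {μ : Measure X} {ρ F : X → ℝ} {U : Set ℝ} {ψ : ℝ → ℝ}

theorem continuous_setIntegral_lt (hρ : Measurable ρ) (hlevel : ∀ s, ∀ᵐ x ∂μ, ρ x ≠ s)
    (hF : Integrable F μ) : Continuous fun s => ∫ x in {x | ρ x < s}, F x ∂μ := by
  have hm (s : ℝ) : MeasurableSet {x | ρ x < s} := measurableSet_lt hρ measurable_const
  simp only [← fun s => integral_indicator (μ := μ) (f := F) (hm s)]
  refine continuous_iff_continuousAt.2 fun s =>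
    continuousAt_of_dominated (bound := fun x => ‖F x‖)
      (.of_forall fun t => hF.aestronglyMeasurable.indicator (hm t))
      (.of_forall fun t => ae_of_all _ fun x => norm_indicator_le_norm_self _ _) hF.norm ?_
  filter_upwards [hlevel s] with x hx
  rcases lt_or_gt_of_ne hx with h | h
  · refine (continuousAt_const (y := F x)).congr ?_
    filter_upwards [lt_mem_nhds h] with t ht using by simp [ht]
  · refine (continuousAt_const (y := (0 : ℝ))).congr ?_
    filter_upwards [gt_mem_nhds h] with t ht using by simp [ht.le]

theorem IsTestOn.integral_Ioi_deriv (hψ : IsTestOn U ψ) (t : ℝ) :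
    ∫ s in Ioi t, _root_.deriv ψ s = -ψ t :=
  hψ.hasCompactSupport.integral_Ioi_deriv_eq (hψ.smooth.of_le (by simp)) t

theorem IsTestOn.integral_mul_comp [SFinite μ] (hψ : IsTestOn U ψ) (hρ : Measurable ρ)
    (hF : Integrable F μ) : ∫ x, F x * ψ (ρ x) ∂μ
      = -∫ s, (∫ x in {x | ρ x < s}, F x ∂μ) * _root_.deriv ψ s := by
  have hm : MeasurableSet {p : X × ℝ | ρ p.1 < p.2} :=
    measurableSet_lt (hρ.comp measurable_fst) measurable_snd
  have hint : Integrable (Function.uncurry fun x s =>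
      F x * (Ioi (ρ x)).indicator (_root_.deriv ψ) s) (μ.prod volume) := by
    refine ((hF.mul_prod hψ.deriv.integrable).indicator hm).congr (ae_of_all _ fun p => ?_)
    by_cases hp : ρ p.1 < p.2 <;> simp [Function.uncurry, hp]
  calc ∫ x, F x * ψ (ρ x) ∂μ
    _ = -∫ x, (∫ s, F x * (Ioi (ρ x)).indicator (_root_.deriv ψ) s) ∂μ := by
      rw [← integral_neg]
      congr with x
      rw [integral_const_mul, integral_indicator measurableSet_Ioi, hψ.integral_Ioi_deriv,
        mul_neg, neg_neg]
    _ = -∫ s, ∫ x, F x * (Ioi (ρ x)).indicator (_root_.deriv ψ) s ∂μ := by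
      rw [integral_integral_swap hint]
    _ = _ := by
      congr 2 with s
      rw [← integral_indicator (measurableSet_lt hρ measurable_const), ← integral_mul_const]
      congr with x
      by_cases hx : ρ x < s <;> simp [hx]

theorem exists_contDiff_integral_mul_comp_eq [SFinite μ] (hρ : Measurable ρ)
    (hlevel : ∀ s, ∀ᵐ x ∂μ, ρ x ≠ s) (hF : Integrable F μ) :
    ∃ H : ℝ → ℝ, ContDiff ℝ 1 H ∧ ∀ U ψ, IsTestOn U ψ →
      ∫ x, F x * ψ (ρ x) ∂μ = ∫ r, H r * deriv (deriv ψ) r := by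
  have hcont := continuous_setIntegral_lt hρ hlevel hF
  have hderiv := hasDerivAt_integral_right hcont 0
  set H : ℝ → ℝ := fun r => ∫ s in (0)..r, ∫ x in {x | ρ x < s}, F x ∂μ
  have hH : ContDiff ℝ 1 H := contDiff_one_iff_deriv.2
    ⟨fun r => (hderiv r).differentiableAt, by rwa [funext fun r => (hderiv r).deriv]⟩
  refine ⟨H, hH, fun U ψ hψ => ?_⟩
  have hloc {g : ℝ → ℝ} (hg : Continuous g) : LocallyIntegrableOn g U :=
    hg.locallyIntegrable.locallyIntegrableOn U
  rw [hψ.integral_mul_comp hρ hF, integral_mul_deriv_eq_deriv_mul_of_integrable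
    (fun x _ => hderiv x) (fun x _ => hψ.deriv.hasDerivAt x)
    (hψ.deriv.deriv.integrable_mul (hloc hH.continuous))
    (hψ.deriv.integrable_mul (hloc hcont)) (hψ.deriv.integrable_mul (hloc hH.continuous))]

end SublevelSets

theorem isCompact_norm_preimage_Icc {E : Type*} [NormedAddCommGroup E] [ProperSpace E] (a b : ℝ) :
    IsCompact (norm ⁻¹' Icc a b : Set E) :=
  (isCompact_closedBall 0 b).of_isClosed_subset (isClosed_Icc.preimage continuous_norm)
    fun x hx => by simpa using hx.2

section Annulus

variable {n : ℕ} {Ω : Set (EuclideanSpace ℝ (Fin n))}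
  {u : EuclideanSpace ℝ (Fin n) → ℝ} {Du : EuclideanSpace ℝ (Fin n) → EuclideanSpace ℝ (Fin n)}
  {D2u : Fin n → EuclideanSpace ℝ (Fin n) → EuclideanSpace ℝ (Fin n)} {a b : ℝ} {g ψ : ℝ → ℝ}

theorem HasWeakGradient.ae_eq_of_profile (hu : HasWeakGradient Ω u Du) (ha : 0 ≤ a)
    (hΩ : norm ⁻¹' Ioo a b ⊆ Ω) {G : ℝ → ℝ} (hG : ContDiff ℝ 1 G)
    (huG : ∀ᵐ x, ‖x‖ ∈ Ioo a b → u x = G ‖x‖) :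
    ∀ᵐ x, ‖x‖ ∈ Ioo a b → Du x = (deriv G ‖x‖ * ‖x‖⁻¹) • x := by
  have hV : IsOpen (norm ⁻¹' Ioo a b : Set (EuclideanSpace ℝ (Fin n))) :=
    isOpen_Ioo.preimage continuous_norm
  have hne : ∀ x ∈ (norm ⁻¹' Ioo a b : Set (EuclideanSpace ℝ (Fin n))), x ≠ 0 :=
    fun x hx => norm_pos_iff.1 (ha.trans_lt hx.1)
  have hgrad : HasWeakGradient (norm ⁻¹' Ioo a b) (fun x => G ‖x‖)
      fun x : EuclideanSpace ℝ (Fin n) => (deriv G ‖x‖ * ‖x‖⁻¹) • x := by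
    refine hasWeakGradient_of_hasGradientAt hV (fun x hx => hasGradientAt_comp_norm (hne x hx)
      (hG.differentiable (by simp) _).hasDerivAt) ?_
    exact ((((hG.continuous_deriv le_rfl).comp continuous_norm).continuousOn).mul
      (continuous_norm.continuousOn.inv₀ fun x hx => norm_ne_zero_iff.2 (hne x hx))).smul
        continuousOn_id
  exact (ae_restrict_iff' hV.measurableSet).1 <|
    (hu.mono hΩ).ae_eq hV hgrad ((ae_restrict_iff' hV.measurableSet).2 huG)

theorem IsTestOn.deriv_pow_succ_mul {U : Set ℝ} (hψ : IsTestOn U ψ) (k : ℕ) (r : ℝ) :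
    _root_.deriv (fun r => r ^ (k + 1) * ψ r) r
      = r ^ k * (r * _root_.deriv ψ r + (k + 1) * ψ r) := by
  refine ((hasDerivAt_pow (k + 1) r).mul (hψ.hasDerivAt r)).deriv.trans ?_
  push_cast [Nat.add_sub_cancel]
  ring

/-- The function `|x|^(-n-1) ∑ xᵢ ∂ⱼ∂ᵢu xⱼ`, cut off outside the annulus `a < |x| < b`; it is
`|x|^(1-n)` times the second radial derivative of `u`. -/
noncomputable def radialHessian (D2u : Fin n → EuclideanSpace ℝ (Fin n) → EuclideanSpace ℝ (Fin n))
    (a b : ℝ) : EuclideanSpace ℝ (Fin n) → ℝ :=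
  (norm ⁻¹' Ioo a b).indicator fun x => (‖x‖ ^ (n + 1))⁻¹ * ∑ i, x i * inner ℝ (D2u i x) x

theorem integrable_radialHessian (ha : 0 < a) (hΩ : norm ⁻¹' Icc a b ⊆ Ω)
    (hD2u : ∀ i, LocallyIntegrableOn (D2u i) Ω) : Integrable (radialHessian D2u a b) := by
  have hK := isCompact_norm_preimage_Icc (E := EuclideanSpace ℝ (Fin n)) a b
  have hsum : IntegrableOn (fun x => ∑ i, x i * inner ℝ (D2u i x) x) (norm ⁻¹' Icc a b) := by
    simp only [PiLp.inner_apply, Finset.mul_sum]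
    refine integrable_finsetSum _ fun i _ => integrable_finsetSum _ fun j _ => ?_
    exact ((((locallyIntegrableOn_coord (hD2u i) j).integrableOn_compact_subset hΩ hK
      ).continuousOn_mul (g := fun x => x j) (by fun_prop) hK).continuousOn_mul (g := fun x => x i)
        (by fun_prop) hK)
  refine (integrable_indicator_iff (measurable_norm measurableSet_Ioo)).2 <|
    (hsum.continuousOn_mul (.inv₀ (by fun_prop) fun x hx => ?_) hK).mono_set
      (preimage_mono Ioo_subset_Icc_self)
  exact pow_ne_zero _ (ha.trans_le hx.1).ne'

/-- The surface area of the unit sphere of `ℝⁿ`, the constant in polar coordinates. -/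
noncomputable def sphereArea (n : ℕ) : ℝ :=
  (volume : Measure (EuclideanSpace ℝ (Fin n))).toSphere.real univ

variable [NeZero n]

theorem sphereArea_pos : 0 < sphereArea n := toSphere_real_univ_pos

theorem setIntegral_eq_sphereArea_mul {F : EuclideanSpace ℝ (Fin n) → ℝ} {q : ℝ → ℝ}
    (ha : 0 ≤ a) (hΩ : norm ⁻¹' Ioo a b ⊆ Ω) (hq : ∀ r ∉ Ioo a b, q r = 0)
    (hF : ∀ᵐ x, F x = q ‖x‖) :
    ∫ x in Ω, F x = sphereArea n * ∫ r, r ^ (n - 1) * q r := by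
  rw [setIntegral_eq_of_ae_eq_comp_norm (fun r hr => ha.trans_lt hr.1) hΩ hq hF,
    finrank_euclideanSpace_fin, sphereArea]

theorem integrableOn_profile (ha : 0 < a) (hΩ : norm ⁻¹' Icc a b ⊆ Ω)
    (hu : LocallyIntegrableOn u Ω) (hg : ∀ᵐ x ∂volume.restrict Ω, u x = g ‖x‖) :
    IntegrableOn g (Icc a b) := by
  have hpos : Icc a b ⊆ Ioi 0 := fun r hr => ha.trans_le hr.1
  have hug : IntegrableOn (fun x : EuclideanSpace ℝ (Fin n) => g ‖x‖) (norm ⁻¹' Icc a b) :=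
    (hu.integrableOn_compact_subset hΩ (isCompact_norm_preimage_Icc a b)).congr_fun_ae
      (ae_restrict_of_ae_restrict_of_subset hΩ hg)
  rw [integrableOn_comp_norm_iff measurableSet_Icc hpos, finrank_euclideanSpace_fin] at hug
  refine (hug.continuousOn_mul (g := fun r => (r ^ (n - 1))⁻¹)
    (.inv₀ (by fun_prop) fun r hr => pow_ne_zero _ (hpos hr).ne') isCompact_Icc).congr_fun
      (fun r hr => ?_) measurableSet_Icc
  exact inv_mul_cancel_left₀ (pow_ne_zero _ (hpos hr).ne') (g r)

theorem IsTestOn.exists_eq_pow_mul (hψ : IsTestOn (Ioo a b) ψ) (ha : 0 < a) :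
    ∃ χ κ : ℝ → ℝ, IsTestOn (Ioo a b) χ ∧ IsTestOn (Ioo a b) κ ∧
      (∀ r, ψ r = r ^ (n + 1) * χ r) ∧ (∀ r, κ r = r * _root_.deriv χ r + (n + 1) * χ r) ∧
      ∀ r, _root_.deriv (_root_.deriv ψ) r
        = r ^ (n - 1) * (r * _root_.deriv κ r + n * κ r) := by
  have hne : ∀ r ∈ Ioo a b, r ^ (n + 1) ≠ 0 := fun r hr => pow_ne_zero _ (ha.trans hr.1).ne'
  set χ : ℝ → ℝ := fun r => (r ^ (n + 1))⁻¹ * ψ r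
  have hχ : IsTestOn (Ioo a b) χ :=
    hψ.mul_left fun r hr => (contDiffAt_id.pow _).inv (hne r hr)
  set κ : ℝ → ℝ := fun r => r * _root_.deriv χ r + (n + 1) * χ r
  have hκ : IsTestOn (Ioo a b) κ := hχ.euler _
  have hψχ : ψ = fun r => r ^ (n + 1) * χ r := by
    funext r
    by_cases hr : r ∈ Ioo a b
    · exact (mul_inv_cancel_left₀ (hne r hr) _).symm
    · rw [hψ.eq_zero hr, hχ.eq_zero hr, mul_zero]
  have hψκ : _root_.deriv ψ = fun r => r ^ n * κ r := by
    rw [hψχ]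
    exact funext fun r => hχ.deriv_pow_succ_mul n r
  refine ⟨χ, κ, hχ, hκ, congrFun hψχ, fun _ => rfl, fun r => ?_⟩
  obtain ⟨m, rfl⟩ := Nat.exists_eq_succ_of_ne_zero (NeZero.ne n)
  rw [hψκ]
  simpa using hκ.deriv_pow_succ_mul m r

theorem HasWeakGradient.sphereArea_mul_integral_deriv_deriv (hu : HasWeakGradient Ω u Du)
    (hDu : ∀ i, HasWeakGradient Ω (fun x => Du x i) (D2u i)) (ha : 0 < a)
    (hΩ : norm ⁻¹' Ioo a b ⊆ Ω) (hug : ∀ᵐ x, ‖x‖ ∈ Ioo a b → u x = g ‖x‖)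
    (hψ : IsTestOn (Ioo a b) ψ) :
    sphereArea n * ∫ r, g r * deriv (deriv ψ) r = ∫ x, radialHessian D2u a b x * ψ ‖x‖ := by
  obtain ⟨χ, κ, hχ, hκ, hψχ, hκχ, hψ''⟩ := hψ.exists_eq_pow_mul ha (n := n)
  have hpolar := setIntegral_eq_sphereArea_mul (Ω := univ) (n := n)
    (F := fun x => u x * (‖x‖ * deriv κ ‖x‖ + n * κ ‖x‖))
    (q := fun r => g r * (r * deriv κ r + n * κ r)) ha.le (subset_univ (norm ⁻¹' Ioo a b))
    (fun r hr => by simp [hκ.eq_zero hr, hκ.deriv.eq_zero hr]) <| by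
      filter_upwards [hug] with x hx
      by_cases hxU : ‖x‖ ∈ Ioo a b
      · rw [hx hxU]
      · simp [hκ.eq_zero hxU, hκ.deriv.eq_zero hxU]
  rw [setIntegral_univ, hu.integral_radial_radial hDu (fun h => ha.not_gt h.1) hΩ hχ hκχ] at hpolar
  calc sphereArea n * ∫ r, g r * deriv (deriv ψ) r
    _ = sphereArea n * ∫ r, r ^ (n - 1) * (g r * (r * deriv κ r + n * κ r)) := by
      simp only [hψ'', mul_left_comm (g _)]
    _ = ∫ x, χ ‖x‖ * ∑ i, x i * inner ℝ (D2u i x) x := hpolar.symm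
    _ = ∫ x, radialHessian D2u a b x * ψ ‖x‖ := by
      congr with x
      by_cases hx : ‖x‖ ∈ Ioo a b
      · have := (ha.trans hx.1).ne'
        simp only [radialHessian, indicator_of_mem (show x ∈ norm ⁻¹' Ioo a b from hx), hψχ]
        field_simp
      · simp [hψ.eq_zero hx, hχ.eq_zero hx]

theorem exists_contDiff_profile (hu : HasWeakGradient Ω u Du)
    (hDu : ∀ i, HasWeakGradient Ω (fun x => Du x i) (D2u i)) (ha : 0 < a) (hab : a < b)
    (hΩ : norm ⁻¹' Icc a b ⊆ Ω) (hrad : IsRadialOn Ω u) :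
    ∃ G : ℝ → ℝ, ContDiff ℝ 1 G ∧ ∀ᵐ x, ‖x‖ ∈ Ioo a b → u x = G ‖x‖ := by
  obtain ⟨g, hg⟩ := hrad
  have hΩ' : norm ⁻¹' Ioo a b ⊆ Ω := (preimage_mono Ioo_subset_Icc_self).trans hΩ
  have hug : ∀ᵐ x, ‖x‖ ∈ Ioo a b → u x = g ‖x‖ :=
    (ae_restrict_iff' (measurable_norm measurableSet_Ioo)).1
      (ae_restrict_of_ae_restrict_of_subset hΩ' hg)
  have hsphere (s : ℝ) : ∀ᵐ x : EuclideanSpace ℝ (Fin n), ‖x‖ ≠ s := by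
    filter_upwards [measure_eq_zero_iff_ae_notMem.1 (Measure.addHaar_sphere volume 0 s)] with x hx
    simpa using hx
  obtain ⟨H, hH, hHψ⟩ := exists_contDiff_integral_mul_comp_eq measurable_norm hsphere
    (integrable_radialHessian ha hΩ fun i => (hDu i).locInt_grad)
  set P : ℝ → ℝ := fun r => (sphereArea n)⁻¹ * H r with hP_def
  have hP : ContDiff ℝ 1 P := contDiff_const.mul hH
  have hg_loc : LocallyIntegrableOn g (Ioo a b) :=
    ((integrableOn_profile ha hΩ hu.locInt hg).mono_set Ioo_subset_Icc_self).locallyIntegrableOn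
  have hP_loc : LocallyIntegrableOn P (Ioo a b) :=
    hP.continuous.locallyIntegrable.locallyIntegrableOn _
  have horth (ψ : ℝ → ℝ) (hψ : IsTestOn (Ioo a b) ψ) :
      ∫ r, (g r - P r) * deriv (deriv ψ) r = 0 := by
    simp only [sub_mul]
    rw [integral_sub (hψ.deriv.deriv.integrable_mul hg_loc)
      (hψ.deriv.deriv.integrable_mul hP_loc)]
    simp only [hP_def, mul_assoc]
    rw [integral_const_mul, ← hHψ _ ψ hψ, ← hu.sphereArea_mul_integral_deriv_deriv hDu ha hΩ' hug
      hψ, inv_mul_cancel_left₀ sphereArea_pos.ne', sub_self]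
  obtain ⟨c, e, hce⟩ :=
    ae_eq_affine_of_integral_mul_deriv_deriv_eq_zero hab (hg_loc.sub hP_loc) horth
  refine ⟨fun r => P r + (c + e * r), by fun_prop, ?_⟩
  filter_upwards [ae_comp_norm hce, hug] with x hx hux hxab
  rw [hux hxab, ← hx hxab, Pi.sub_apply, add_sub_cancel]

end Annulus

section Flux

/-- The flux `φ(v) = v / √(1 + v²)` of the mean curvature operator. -/
noncomputable def flux (v : ℝ) : ℝ := v / √(1 + v ^ 2)

theorem sqrt_one_add_sq_pos (v : ℝ) : 0 < √(1 + v ^ 2) := Real.sqrt_pos.2 (by positivity)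

theorem contDiff_flux : ContDiff ℝ ∞ flux :=
  contDiff_id.div ((contDiff_const.add (contDiff_id.pow 2)).sqrt fun v => by positivity)
    fun v => (sqrt_one_add_sq_pos v).ne'

theorem hasDerivAt_flux (v : ℝ) : HasDerivAt flux (deriv flux v) v :=
  (contDiff_flux.differentiable (by simp) v).hasDerivAt

theorem deriv_flux (v : ℝ) : deriv flux v = ((1 + v ^ 2) * √(1 + v ^ 2))⁻¹ := by
  have hpos := sqrt_one_add_sq_pos v
  have hsq : √(1 + v ^ 2) ^ 2 = 1 + v ^ 2 := Real.sq_sqrt (by positivity)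
  have h1 : HasDerivAt (fun v : ℝ => 1 + v ^ 2) (2 * v) v := by
    simpa using (hasDerivAt_pow 2 v).const_add 1
  have h2 := (hasDerivAt_id v).div (h1.sqrt (by positivity)) hpos.ne'
  refine h2.deriv.trans ?_
  simp only [id]
  field_simp
  rw [hsq]
  ring

theorem one_sub_flux_sq (v : ℝ) : 1 - flux v ^ 2 = (1 + v ^ 2)⁻¹ := by
  rw [flux, div_pow, Real.sq_sqrt (by positivity)]
  field_simp
  ring

theorem flux_div_sqrt_one_sub_sq (v : ℝ) : flux v / √(1 - flux v ^ 2) = v := by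
  rw [one_sub_flux_sq, Real.sqrt_inv, div_inv_eq_mul, flux,
    div_mul_cancel₀ _ (sqrt_one_add_sq_pos v).ne']

theorem contDiffAt_of_flux {E : Type*} [NormedAddCommGroup E] [NormedSpace ℝ E] {v : E → ℝ}
    {x : E} {k : WithTop ℕ∞} (h : ContDiffAt ℝ k (fun y => flux (v y)) x) :
    ContDiffAt ℝ k v x := by
  have hpos : 0 < 1 - flux (v x) ^ 2 := by
    rw [one_sub_flux_sq]
    positivity
  refine (h.div ((contDiffAt_const.sub (h.pow 2)).sqrt hpos.ne')
    (Real.sqrt_pos.2 hpos).ne').congr_of_eventuallyEq ?_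
  exact .of_forall fun y => (flux_div_sqrt_one_sub_sq (v y)).symm

theorem deriv_flux_mul_sq_le_one (v : ℝ) : deriv flux v * v ^ 2 ≤ 1 := by
  have h : 1 ≤ √(1 + v ^ 2) := Real.one_le_sqrt.2 (by nlinarith [sq_nonneg v])
  rw [deriv_flux, inv_mul_le_one₀ (by positivity)]
  nlinarith [sq_nonneg v]

theorem flux_mul_self_nonneg (v : ℝ) : 0 ≤ flux v * v := by
  rw [flux, div_mul_eq_mul_div]
  exact div_nonneg (mul_self_nonneg v) (Real.sqrt_nonneg _)

theorem deriv_flux_nonneg (v : ℝ) : 0 ≤ deriv flux v := by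
  rw [deriv_flux]
  positivity

theorem abs_le_one_add_two_mul_flux_mul (v : ℝ) : |v| ≤ 1 + 2 * (flux v * v) := by
  rcases le_or_gt |v| 1 with hv | hv
  · linarith [flux_mul_self_nonneg v]
  · have hsqrt : √(1 + v ^ 2) ≤ 2 * |v| := by
      rw [Real.sqrt_le_left (by positivity), ← sq_abs v]
      nlinarith
    have hhalf : |v| / 2 ≤ flux v * v := by
      rw [flux, div_mul_eq_mul_div, le_div_iff₀ (sqrt_one_add_sq_pos v)]
      nlinarith [sq_abs v]
    linarith

theorem sq_div_sqrt_sub_sq_div_rpow (s t : ℝ) :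
    t ^ 2 / √(1 + s ^ 2) - (s * t) ^ 2 / (1 + s ^ 2) ^ (3 / 2 : ℝ) = deriv flux s * t ^ 2 := by
  have hpos : 0 < 1 + s ^ 2 := by positivity
  have hrpow : (1 + s ^ 2) ^ (3 / 2 : ℝ) = (1 + s ^ 2) * √(1 + s ^ 2) := by
    rw [Real.sqrt_eq_rpow, show (3 / 2 : ℝ) = 1 + 1 / 2 by norm_num, Real.rpow_add hpos,
      Real.rpow_one]
  have := sqrt_one_add_sq_pos s
  rw [hrpow, deriv_flux]
  field_simp
  ring

end Flux

/-- A stable radial profile on the interval `(a, b)`: the function `G` of the radius satisfies, in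
weak form, `(r^m φ(G'))' = -r^m f(G)` and the stability inequality for radial variations. In
dimension `n` the weight exponent is `m = n - 1`. -/
structure IsStableProfile (m : ℕ) (f : ℝ → ℝ) (a b : ℝ) (G : ℝ → ℝ) : Prop where
  contDiff : ContDiff ℝ 1 G
  equation : ∀ χ, IsTestOn (Ioo a b) χ →
    ∫ r, r ^ m * flux (deriv G r) * deriv χ r = ∫ r, r ^ m * f (G r) * χ r
  stable : ∀ χ, IsTestOn (Ioo a b) χ →
    ∫ r, r ^ m * deriv f (G r) * χ r ^ 2 ≤ ∫ r, r ^ m * deriv flux (deriv G r) * deriv χ r ^ 2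

section RadialReduction

theorem inner_radial {E : Type*} [NormedAddCommGroup E] [InnerProductSpace ℝ E] {x : E}
    (hx : x ≠ 0) (s t : ℝ) : inner ℝ ((s * ‖x‖⁻¹) • x) ((t * ‖x‖⁻¹) • x) = s * t := by
  have := norm_pos_iff.2 hx
  rw [real_inner_smul_left, real_inner_smul_right, real_inner_self_eq_norm_sq]
  field_simp

theorem norm_radial {E : Type*} [NormedAddCommGroup E] [NormedSpace ℝ E] {x : E}
    (hx : x ≠ 0) (s : ℝ) : ‖(s * ‖x‖⁻¹) • x‖ = |s| := by
  rw [norm_smul, norm_mul, norm_inv, norm_norm, inv_mul_cancel_right₀ (norm_ne_zero_iff.2 hx),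
    Real.norm_eq_abs]

variable {n : ℕ} [NeZero n] {Ω : Set (EuclideanSpace ℝ (Fin n))} {f G : ℝ → ℝ} {a b : ℝ}
  {u : EuclideanSpace ℝ (Fin n) → ℝ} {Du : EuclideanSpace ℝ (Fin n) → EuclideanSpace ℝ (Fin n)}

theorem IsWeakSolution.profile_equation (hu : IsWeakSolution f Ω u Du) (ha : 0 ≤ a)
    (hΩ : norm ⁻¹' Ioo a b ⊆ Ω) (huG : ∀ᵐ x, ‖x‖ ∈ Ioo a b → u x = G ‖x‖)
    (hDuG : ∀ᵐ x, ‖x‖ ∈ Ioo a b → Du x = (deriv G ‖x‖ * ‖x‖⁻¹) • x)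
    {χ : ℝ → ℝ} (hχ : IsTestOn (Ioo a b) χ) :
    ∫ r, r ^ (n - 1) * flux (deriv G r) * deriv χ r = ∫ r, r ^ (n - 1) * f (G r) * χ r := by
  have h0 : (0 : ℝ) ∉ Ioo a b := fun h => h.1.not_ge ha
  have hweak := hu.equation _ (hχ.isTestFunction h0 hΩ)
  rw [setIntegral_eq_sphereArea_mul ha hΩ (q := fun r => flux (deriv G r) * deriv χ r)
      (fun r hr => by simp only [hχ.deriv.eq_zero hr, mul_zero]) ?_,
    setIntegral_eq_sphereArea_mul ha hΩ (q := fun r => f (G r) * χ r)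
      (fun r hr => by simp only [hχ.eq_zero hr, mul_zero]) ?_] at hweak
  · simpa only [mul_assoc] using mul_left_cancel₀ sphereArea_pos.ne' hweak
  · filter_upwards [huG] with x hx
    by_cases hxab : ‖x‖ ∈ Ioo a b
    · rw [hx hxab]
    · simp only [hχ.eq_zero hxab, mul_zero]
  · filter_upwards [hDuG] with x hx
    rw [hχ.gradient_comp_norm h0]
    by_cases hxab : ‖x‖ ∈ Ioo a b
    · have hx0 : x ≠ 0 := norm_pos_iff.1 (ha.trans_lt hxab.1)
      rw [hx hxab, inner_radial hx0, norm_radial hx0, sq_abs, flux, div_mul_eq_mul_div]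
    · simp only [hχ.deriv.eq_zero hxab, zero_mul, zero_smul, inner_zero_right, zero_div, mul_zero]

theorem IsStableSolution.profile_stable (hu : IsStableSolution f Ω u Du) (ha : 0 ≤ a)
    (hΩ : norm ⁻¹' Ioo a b ⊆ Ω) (huG : ∀ᵐ x, ‖x‖ ∈ Ioo a b → u x = G ‖x‖)
    (hDuG : ∀ᵐ x, ‖x‖ ∈ Ioo a b → Du x = (deriv G ‖x‖ * ‖x‖⁻¹) • x)
    {χ : ℝ → ℝ} (hχ : IsTestOn (Ioo a b) χ) :
    ∫ r, r ^ (n - 1) * deriv f (G r) * χ r ^ 2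
      ≤ ∫ r, r ^ (n - 1) * deriv flux (deriv G r) * deriv χ r ^ 2 := by
  have h0 : (0 : ℝ) ∉ Ioo a b := fun h => h.1.not_ge ha
  have hstable := hu.stable _ (hχ.isTestFunction h0 hΩ)
  rw [setIntegral_eq_sphereArea_mul ha hΩ (q := fun r => deriv f (G r) * χ r ^ 2)
      (fun r hr => by simp [hχ.eq_zero hr]) ?_,
    setIntegral_eq_sphereArea_mul ha hΩ
      (q := fun r => deriv flux (deriv G r) * deriv χ r ^ 2)
      (fun r hr => by simp [hχ.deriv.eq_zero hr]) ?_] at hstable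
  · simpa only [mul_assoc] using le_of_mul_le_mul_left hstable sphereArea_pos
  · filter_upwards [hDuG] with x hx
    rw [hχ.gradient_comp_norm h0]
    by_cases hxab : ‖x‖ ∈ Ioo a b
    · have hx0 : x ≠ 0 := norm_pos_iff.1 (ha.trans_lt hxab.1)
      rw [hx hxab, inner_radial hx0, norm_radial hx0, norm_radial hx0, sq_abs, sq_abs,
        sq_div_sqrt_sub_sq_div_rpow]
    · simp [hχ.deriv.eq_zero hxab]
  · filter_upwards [huG] with x hx
    by_cases hxab : ‖x‖ ∈ Ioo a b
    · rw [hx hxab]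
    · simp [hχ.eq_zero hxab]

theorem IsStableSolution.exists_isStableProfile (hu : IsStableSolution f Ω u Du)
    (hu2 : MemSobolevLoc Ω 2 u) (hrad : IsRadialOn Ω u) (ha : 0 < a) (hab : a < b)
    (hΩ : norm ⁻¹' Icc a b ⊆ Ω) :
    ∃ G, IsStableProfile (n - 1) f a b G ∧
      ∀ᵐ x, ‖x‖ ∈ Ioo a b → Du x = (deriv G ‖x‖ * ‖x‖⁻¹) • x := by
  obtain ⟨Dv, hDv, hDv1⟩ := hu2
  choose D2v hD2v _ using hDv1
  have hΩ' : norm ⁻¹' Ioo a b ⊆ Ω := (preimage_mono Ioo_subset_Icc_self).trans hΩ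
  obtain ⟨G, hG, huG⟩ := exists_contDiff_profile hDv hD2v ha hab hΩ hrad
  have hDuG := hu.weakGradient.ae_eq_of_profile ha.le hΩ' hG huG
  exact ⟨G, ⟨hG, fun _ hχ => hu.toIsWeakSolution.profile_equation ha.le hΩ' huG hDuG hχ,
    fun _ hχ => hu.profile_stable ha.le hΩ' huG hDuG hχ⟩, hDuG⟩

end RadialReduction

theorem integrable_mul_sq_of_tsupport_subset {U : Set ℝ} {p w : ℝ → ℝ} (hU : MeasurableSet U)
    (hp : ContinuousOn p U) (hw : Continuous w) (hc : HasCompactSupport w) (hwU : tsupport w ⊆ U) :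
    Integrable (fun r => p r * w r ^ 2) := by
  simp only [sq]
  exact integrable_mul_of_tsupport_subset (hp.locallyIntegrableOn hU) (hw.mul hw) hc.mul_left
    (tsupport_mul_subset_right.trans hwU)

theorem hasDerivAt_pow_mul (m : ℕ) {g : ℝ → ℝ} {g' r : ℝ} (hr : r ≠ 0) (hg : HasDerivAt g g' r) :
    HasDerivAt (fun r => r ^ m * g r) (m * (r ^ m * g r / r) + r ^ m * g') r := by
  refine ((hasDerivAt_pow m r).mul hg).congr_deriv ?_
  cases m with
  | zero => simp
  | succ k =>
    rw [Nat.add_sub_cancel]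
    field_simp
    ring

theorem exists_eqOn_of_integral_mul_deriv_eq {a b : ℝ} (hab : a < b) {W F : ℝ → ℝ}
    (hW : Continuous W) (hF : Continuous F)
    (H : ∀ χ, IsTestOn (Ioo a b) χ → ∫ r, W r * deriv χ r = ∫ r, F r * χ r) :
    ∃ P : ℝ → ℝ, ContDiff ℝ 1 P ∧ (∀ r, HasDerivAt P (-F r) r) ∧ EqOn W P (Ioo a b) := by
  set Q : ℝ → ℝ := fun r => ∫ s in a..r, F s
  have hQ : ∀ r, HasDerivAt Q (F r) r := hasDerivAt_integral_right hF a
  have hQ1 : ContDiff ℝ 1 Q := contDiff_one_iff_deriv.2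
    ⟨fun r => (hQ r).differentiableAt, by rwa [funext fun r => (hQ r).deriv]⟩
  have hloc {p : ℝ → ℝ} (hp : Continuous p) : LocallyIntegrableOn p (Ioo a b) :=
    hp.locallyIntegrable.locallyIntegrableOn _
  obtain ⟨c, hc⟩ := ae_eq_const_of_integral_mul_deriv_eq_zero hab
    (hloc (hW.add hQ1.continuous)) fun χ hχ => by
      have hparts := integral_mul_deriv_eq_deriv_mul_of_integrable (fun r _ => hQ r)
        (fun r _ => hχ.hasDerivAt r) (hχ.deriv.integrable_mul (hloc hQ1.continuous))
        (hχ.integrable_mul (hloc hF)) (hχ.integrable_mul (hloc hQ1.continuous))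
      simp only [Pi.add_apply, add_mul]
      rw [integral_add (hχ.deriv.integrable_mul (hloc hW))
        (hχ.deriv.integrable_mul (hloc hQ1.continuous)), H χ hχ, hparts, add_neg_cancel]
  have heq : EqOn (fun r => W r + Q r) (fun _ => c) (Ioo a b) :=
    Measure.eqOn_open_of_ae_eq (μ := volume) ((ae_restrict_iff' measurableSet_Ioo).2 hc)
      isOpen_Ioo (hW.add hQ1.continuous).continuousOn continuousOn_const
  exact ⟨fun r => c - Q r, contDiff_const.sub hQ1, fun r => (hQ r).const_sub c,
    fun r hr => eq_sub_of_add_eq (heq hr)⟩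

namespace IsStableProfile

variable {m : ℕ} {f G η : ℝ → ℝ} {a b r : ℝ}

theorem continuous_deriv (h : IsStableProfile m f a b G) : Continuous (deriv G) :=
  h.contDiff.continuous_deriv le_rfl

theorem hasDerivAt (h : IsStableProfile m f a b G) (r : ℝ) : HasDerivAt G (deriv G r) r :=
  (h.contDiff.differentiable (by simp) r).hasDerivAt

theorem exists_eqOn_pow_mul_flux (h : IsStableProfile m f a b G) (hf : Continuous f)
    (hr : r ∈ Ioo a b) :
    ∃ P : ℝ → ℝ, ContDiff ℝ 1 P ∧ (∀ r, HasDerivAt P (-(r ^ m * f (G r))) r) ∧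
      EqOn (fun r => r ^ m * flux (deriv G r)) P (Ioo a b) :=
  exists_eqOn_of_integral_mul_deriv_eq (hr.1.trans hr.2)
    ((continuous_pow m).mul (contDiff_flux.continuous.comp h.continuous_deriv))
    ((continuous_pow m).mul (hf.comp h.contDiff.continuous)) h.equation

theorem hasDerivAt_pow_mul_flux (h : IsStableProfile m f a b G) (hf : Continuous f)
    (hr : r ∈ Ioo a b) :
    HasDerivAt (fun r => r ^ m * flux (deriv G r)) (-(r ^ m * f (G r))) r := by
  obtain ⟨P, -, hP, heq⟩ := h.exists_eqOn_pow_mul_flux hf hr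
  exact (hP r).congr_of_eventuallyEq (heq.eventuallyEq_of_mem (isOpen_Ioo.mem_nhds hr))

theorem contDiffAt_deriv (h : IsStableProfile m f a b G) (hf : Continuous f) (ha : 0 ≤ a)
    (hr : r ∈ Ioo a b) : ContDiffAt ℝ 1 (deriv G) r := by
  obtain ⟨P, hP, -, heq⟩ := h.exists_eqOn_pow_mul_flux hf hr
  refine contDiffAt_of_flux <| (((contDiffAt_id.pow m).inv
    (pow_ne_zero m (ha.trans_lt hr.1).ne')).mul hP.contDiffAt).congr_of_eventuallyEq ?_
  filter_upwards [isOpen_Ioo.mem_nhds hr] with s hs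
  rw [← heq hs]
  exact (inv_mul_cancel_left₀ (pow_ne_zero m (ha.trans_lt hs.1).ne') _).symm

theorem hasDerivAt_deriv (h : IsStableProfile m f a b G) (hf : Continuous f) (ha : 0 ≤ a)
    (hr : r ∈ Ioo a b) : HasDerivAt (deriv G) (deriv (deriv G) r) r :=
  ((h.contDiffAt_deriv hf ha hr).differentiableAt (by simp)).hasDerivAt

theorem pow_mul_deriv_flux_mul (h : IsStableProfile m f a b G) (hf : Continuous f) (ha : 0 ≤ a)
    (hr : r ∈ Ioo a b) :
    r ^ m * deriv flux (deriv G r) * deriv (deriv G) r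
      = -(r ^ m * f (G r)) - m * (r ^ m * flux (deriv G r) / r) := by
  have hr0 : r ≠ 0 := (ha.trans_lt hr.1).ne'
  have hprod := hasDerivAt_pow_mul m hr0
    ((hasDerivAt_flux (deriv G r)).comp r (h.hasDerivAt_deriv hf ha hr))
  have heq : _ = m * (r ^ m * flux (deriv G r) / r) + _ :=
    (h.hasDerivAt_pow_mul_flux hf hr).unique hprod
  rw [heq, add_sub_cancel_left, mul_assoc]

theorem hasDerivAt_pow_mul_deriv_flux_mul (h : IsStableProfile m f a b G) (hf : ContDiff ℝ 1 f)
    (ha : 0 ≤ a) (hr : r ∈ Ioo a b) :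
    HasDerivAt (fun r => r ^ m * deriv flux (deriv G r) * deriv (deriv G) r)
      (m * (r ^ m * flux (deriv G r) / r ^ 2) - r ^ m * deriv f (G r) * deriv G r) r := by
  have hr0 : r ≠ 0 := (ha.trans_lt hr.1).ne'
  have hforce := hasDerivAt_pow_mul m hr0
    (((hf.differentiable (by simp) _).hasDerivAt).comp r (h.hasDerivAt r))
  have hquot := (((h.hasDerivAt_pow_mul_flux hf.continuous hr).div (hasDerivAt_id r) hr0).const_mul
    (m : ℝ))
  have hdiff := (hforce.neg.sub hquot).congr_of_eventuallyEq
    (f₁ := fun r => r ^ m * deriv flux (deriv G r) * deriv (deriv G) r) <| by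
      filter_upwards [isOpen_Ioo.mem_nhds hr] with s hs
      exact h.pow_mul_deriv_flux_mul hf.continuous ha hs
  refine hdiff.congr_deriv ?_
  simp only [Function.comp_apply, id]
  field_simp
  ring

end IsStableProfile

section Picone

variable {U : Set ℝ} {p q c v η : ℝ → ℝ}

theorem contDiff_mul_of_tsupport_subset (hv : ∀ r ∈ U, ContDiffAt ℝ 1 v r) (hη : ContDiff ℝ 1 η)
    (hηU : tsupport η ⊆ U) : ContDiff ℝ 1 (fun r => v r * η r) :=
  contDiff_of_tsupport fun r hr =>
    (hv r (hηU (tsupport_mul_subset_right hr))).mul hη.contDiffAt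

theorem hasDerivAt_picone (hv : ∀ r ∈ U, ContDiffAt ℝ 1 v r)
    (hqv : ∀ r ∈ U, HasDerivAt (fun r => q r * deriv v r) (c r - p r * v r) r)
    (hη : ContDiff ℝ 1 η) (hηU : tsupport η ⊆ U) (r : ℝ) :
    HasDerivAt (fun r => q r * deriv v r * (v r * η r * η r))
      (c r * v r * η r ^ 2 - p r * (v r * η r) ^ 2
        + (q r * deriv (fun r => v r * η r) r ^ 2 - q r * v r ^ 2 * deriv η r ^ 2)) r := by
  have hη' := (hη.differentiable (by simp) r).hasDerivAt
  by_cases hr : r ∈ tsupport η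
  · have hw := ((hv r (hηU hr)).differentiableAt (by simp)).hasDerivAt.mul hη'
    refine ((hqv r (hηU hr)).mul (hw.mul hη')).congr_deriv ?_
    -- Picone's identity: `q (v η)'² - q v² η'² = q v' (v η²)'`.
    rw [show deriv (fun r => v r * η r) r = _ from hw.deriv]
    simp only [Pi.mul_apply]
    ring
  · have hzero := notMem_tsupport_iff_eventuallyEq.1 hr
    have hw : (fun r => v r * η r) =ᶠ[𝓝 r] 0 := hzero.mono fun s hs => by simp [hs]
    refine ((hasDerivAt_const r (0 : ℝ)).congr_of_eventuallyEq
      (hzero.mono fun s hs => by simp [hs])).congr_deriv ?_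
    simp [hzero.eq_of_nhds, hzero.deriv_eq, hw.deriv_eq]

theorem integral_picone (hU : IsOpen U) (hp : ContinuousOn p U) (hq : ContinuousOn q U)
    (hc : ContinuousOn c U) (hv : ∀ r ∈ U, ContDiffAt ℝ 1 v r)
    (hqv : ∀ r ∈ U, HasDerivAt (fun r => q r * deriv v r) (c r - p r * v r) r)
    (hη : ContDiff ℝ 1 η) (hηc : HasCompactSupport η) (hηU : tsupport η ⊆ U) :
    (∫ r, q r * deriv (fun r => v r * η r) r ^ 2) - ∫ r, p r * (v r * η r) ^ 2
      = (∫ r, q r * v r ^ 2 * deriv η r ^ 2) - ∫ r, c r * v r * η r ^ 2 := by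
  have hw := contDiff_mul_of_tsupport_subset hv hη hηU
  have hwc : HasCompactSupport fun r => v r * η r := hηc.mul_left
  have hwU : tsupport (fun r => v r * η r) ⊆ U := tsupport_mul_subset_right.trans hηU
  have hvU : ContinuousOn v U := fun r hr => (hv r hr).continuousAt.continuousWithinAt
  have hIc := integrable_mul_sq_of_tsupport_subset (p := fun r => c r * v r) hU.measurableSet
    (hc.mul hvU) hη.continuous hηc hηU
  have hIp := integrable_mul_sq_of_tsupport_subset hU.measurableSet hp hw.continuous hwc hwU
  have hIq := integrable_mul_sq_of_tsupport_subset hU.measurableSet hq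
    (hw.continuous_deriv le_rfl) hwc.deriv (tsupport_deriv_subset.trans hwU)
  have hIq' := integrable_mul_sq_of_tsupport_subset (p := fun r => q r * v r ^ 2) hU.measurableSet
    (hq.mul (hvU.pow 2)) (hη.continuous_deriv le_rfl) hηc.deriv (tsupport_deriv_subset.trans hηU)
  have hprim := hasDerivAt_picone hv hqv hη hηU
  have hsupp : HasCompactSupport fun r => q r * deriv v r * (v r * η r * η r) :=
    (hηc.mul_left (f := fun r => v r * η r)).mul_left (f := fun r => q r * deriv v r)
  have hint : Integrable fun r => q r * deriv v r * (v r * η r * η r) :=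
    Continuous.integrable_of_hasCompactSupport
      (continuous_iff_continuousAt.2 fun r => (hprim r).continuousAt) hsupp
  have hzero := integral_eq_zero_of_hasDerivAt_of_integrable hprim
    ((hIc.sub hIp).add (hIq.sub hIq')) hint
  have hsum := integral_add' (hIc.sub hIp) (hIq.sub hIq')
  rw [integral_sub' hIc hIp, integral_sub' hIq hIq'] at hsum
  linarith [hsum.symm.trans hzero]

end Picone

theorem IsStableProfile.mul_integral_le {m : ℕ} {f G η : ℝ → ℝ} {a b : ℝ}
    (h : IsStableProfile m f a b G) (hf : ContDiff ℝ 1 f) (ha : 0 ≤ a) (hη : ContDiff ℝ 1 η)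
    (hηc : HasCompactSupport η) (hηU : tsupport η ⊆ Ioo a b) :
    m * ∫ r, r ^ m / r ^ 2 * (flux (deriv G r) * deriv G r) * η r ^ 2
      ≤ ∫ r, r ^ m * (deriv flux (deriv G r) * deriv G r ^ 2) * deriv η r ^ 2 := by
  have hv : ∀ r ∈ Ioo a b, ContDiffAt ℝ 1 (deriv G) r :=
    fun r hr => h.contDiffAt_deriv hf.continuous ha hr
  have hp : Continuous fun r => r ^ m * deriv f (G r) :=
    (continuous_pow m).mul ((hf.continuous_deriv le_rfl).comp h.contDiff.continuous)
  have hq : Continuous fun r => r ^ m * deriv flux (deriv G r) :=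
    (continuous_pow m).mul ((contDiff_flux.continuous_deriv (by simp)).comp h.continuous_deriv)
  have hc : ContinuousOn (fun r => m * (r ^ m * flux (deriv G r) / r ^ 2)) (Ioo a b) :=
    continuousOn_const.mul ((((continuous_pow m).mul
      (contDiff_flux.continuous.comp h.continuous_deriv)).continuousOn).div (by fun_prop)
        fun r hr => pow_ne_zero 2 (ha.trans_lt hr.1).ne')
  have hpicone := integral_picone isOpen_Ioo hp.continuousOn hq.continuousOn hc hv
    (fun r hr => h.hasDerivAt_pow_mul_deriv_flux_mul hf ha hr) hη hηc hηU
  have hstable := integral_mul_sq_le_of_forall_isTestOn isOpen_Ioo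
    (hp.integrableOn_Icc.mono_set Ioo_subset_Icc_self)
    (hq.integrableOn_Icc.mono_set Ioo_subset_Icc_self) h.stable
    (contDiff_mul_of_tsupport_subset hv hη hηU) hηc.mul_left
    (tsupport_mul_subset_right.trans hηU)
  rw [← integral_const_mul]
  calc ∫ r, m * (r ^ m / r ^ 2 * (flux (deriv G r) * deriv G r) * η r ^ 2)
      = ∫ r, m * (r ^ m * flux (deriv G r) / r ^ 2) * deriv G r * η r ^ 2 := by
        congr with r
        ring
    _ ≤ ∫ r, r ^ m * deriv flux (deriv G r) * deriv G r ^ 2 * deriv η r ^ 2 := by linarith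
    _ = _ := by simp only [mul_assoc]

section Cutoff

/-- A smooth cutoff with support in `[ε, 3 / 2]`, equal to `1` on `[2ε, 1]`, whose derivative is
of order `1 / r` at radius `r` uniformly in `ε`. -/
noncomputable def annularCutoff (ε r : ℝ) : ℝ :=
  Real.smoothTransition (r / ε - 1) * Real.smoothTransition (3 - 2 * r)

theorem hasDerivAt_smoothTransition (x : ℝ) :
    HasDerivAt Real.smoothTransition (deriv Real.smoothTransition x) x :=
  ((Real.smoothTransition.contDiff (n := 1)).differentiable (by simp) x).hasDerivAt

theorem hasCompactSupport_deriv_smoothTransition :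
    HasCompactSupport (deriv Real.smoothTransition) := by
  refine .intro (K := Icc 0 1) isCompact_Icc fun x hx => ?_
  rcases lt_or_ge x 0 with hx0 | hx0
  · have hloc : Real.smoothTransition =ᶠ[𝓝 x] fun _ => 0 :=
      (gt_mem_nhds hx0).mono fun y hy => Real.smoothTransition.zero_of_nonpos hy.le
    rw [hloc.deriv_eq, deriv_const]
  · have hloc : Real.smoothTransition =ᶠ[𝓝 x] fun _ => 1 :=
      (lt_mem_nhds (not_le.1 fun h => hx ⟨hx0, h⟩)).mono fun y hy =>
        Real.smoothTransition.one_of_one_le hy.le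
    rw [hloc.deriv_eq, deriv_const]

theorem exists_bound_sub_mul_deriv_smoothTransition (c : ℝ) :
    ∃ M, ∀ x, |(c - x) * deriv Real.smoothTransition x| ≤ M :=
  hasCompactSupport_deriv_smoothTransition.mul_left.exists_bound_of_continuous
    ((continuous_const.sub continuous_id).mul
      ((Real.smoothTransition.contDiff (n := 1)).continuous_deriv le_rfl))

variable {ε r : ℝ}

theorem contDiff_annularCutoff (ε : ℝ) : ContDiff ℝ 1 (annularCutoff ε) :=
  (Real.smoothTransition.contDiff.comp (by fun_prop)).mul
    (Real.smoothTransition.contDiff.comp (by fun_prop))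

theorem annularCutoff_nonneg (ε r : ℝ) : 0 ≤ annularCutoff ε r :=
  mul_nonneg (Real.smoothTransition.nonneg _) (Real.smoothTransition.nonneg _)

theorem annularCutoff_le_one (ε r : ℝ) : annularCutoff ε r ≤ 1 :=
  mul_le_one₀ (Real.smoothTransition.le_one _) (Real.smoothTransition.nonneg _)
    (Real.smoothTransition.le_one _)

theorem annularCutoff_eq_one (hε : 0 < ε) (hr : r ∈ Icc (2 * ε) 1) : annularCutoff ε r = 1 := by
  have h2 : 2 ≤ r / ε := (le_div_iff₀ hε).2 hr.1
  rw [annularCutoff, Real.smoothTransition.one_of_one_le (by linarith),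
    Real.smoothTransition.one_of_one_le (by linarith [hr.2]), one_mul]

theorem tsupport_annularCutoff_subset (hε : 0 < ε) :
    tsupport (annularCutoff ε) ⊆ Icc ε (3 / 2) := by
  refine closure_minimal (fun r hr => ?_) isClosed_Icc
  by_contra hrI
  refine hr ?_
  rcases lt_or_ge r ε with hlt | hge
  · rw [annularCutoff, Real.smoothTransition.zero_of_nonpos, zero_mul]
    linarith [(div_lt_one hε).2 hlt]
  · have hgt : 3 / 2 < r := not_le.1 fun h => hrI ⟨hge, h⟩
    rw [annularCutoff, Real.smoothTransition.zero_of_nonpos (x := 3 - 2 * r) (by linarith),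
      mul_zero]

theorem exists_bound_mul_deriv_annularCutoff :
    ∃ M, ∀ ε r, 0 < ε → |r * deriv (annularCutoff ε) r| ≤ M := by
  obtain ⟨M₁, hM₁⟩ := exists_bound_sub_mul_deriv_smoothTransition (-1)
  obtain ⟨M₂, hM₂⟩ := exists_bound_sub_mul_deriv_smoothTransition 3
  refine ⟨M₁ + M₂, fun ε r hε => ?_⟩
  set S := Real.smoothTransition
  have hinner : HasDerivAt (fun r => S (r / ε - 1)) (deriv S (r / ε - 1) * (1 / ε)) r :=
    (hasDerivAt_smoothTransition _).comp r (((hasDerivAt_id r).div_const ε).sub_const 1)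
  have houter : HasDerivAt (fun r => S (3 - 2 * r)) (deriv S (3 - 2 * r) * (-(2 * 1))) r :=
    (hasDerivAt_smoothTransition _).comp r (((hasDerivAt_id r).const_mul 2).const_sub 3)
  have hderiv : r * deriv (annularCutoff ε) r
      = -((-1 - (r / ε - 1)) * deriv S (r / ε - 1)) * S (3 - 2 * r)
        + -((3 - (3 - 2 * r)) * deriv S (3 - 2 * r)) * S (r / ε - 1) := by
    rw [show deriv (annularCutoff ε) r = _ from (hinner.mul houter).deriv]
    field_simp
    ring
  have hS (x y M : ℝ) (hx : |x| ≤ M) : |-x * S y| ≤ M := by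
    rw [abs_mul, abs_neg, abs_of_nonneg (Real.smoothTransition.nonneg y)]
    exact (mul_le_of_le_one_right (abs_nonneg x) (Real.smoothTransition.le_one y)).trans hx
  rw [hderiv]
  exact (abs_add_le _ _).trans (add_le_add (hS _ _ _ (hM₁ _)) (hS _ _ _ (hM₂ _)))

theorem exists_truncated_rpow (β : ℝ) : ∃ D : ℝ, ∀ ε, 0 < ε → ∃ η : ℝ → ℝ, ContDiff ℝ 1 η ∧
    tsupport η ⊆ Icc ε (3 / 2) ∧ (∀ r ∈ Icc (2 * ε) 1, η r = r ^ (-β)) ∧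
    ∀ r, 0 < r → |r * deriv η r| ≤ D * r ^ (-β) := by
  obtain ⟨M, hM⟩ := exists_bound_mul_deriv_annularCutoff
  refine ⟨|β| + M, fun ε hε => ⟨fun r => r ^ (-β) * annularCutoff ε r, ?_,
    tsupport_mul_subset_right.trans (tsupport_annularCutoff_subset hε), fun r hr => ?_,
    fun r hr => ?_⟩⟩
  · refine contDiff_of_tsupport fun r hr => ?_
    have hr' := tsupport_annularCutoff_subset hε (tsupport_mul_subset_right hr)
    exact (Real.contDiffAt_rpow_const_of_ne (hε.trans_le hr'.1).ne').mul
      (contDiff_annularCutoff ε).contDiffAt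
  · simp only [annularCutoff_eq_one hε hr, mul_one]
  · have hcut := ((contDiff_annularCutoff ε).differentiable (by simp) r).hasDerivAt
    have hrpow : r * r ^ (-β - 1) = r ^ (-β) := by
      rw [Real.rpow_sub_one hr.ne', mul_div_cancel₀ _ hr.ne']
    have hderiv : r * deriv (fun r => r ^ (-β) * annularCutoff ε r) r
        = (-β * annularCutoff ε r + r * deriv (annularCutoff ε) r) * r ^ (-β) := by
      rw [show deriv (fun r => r ^ (-β) * annularCutoff ε r) r = _ from
        ((Real.hasDerivAt_rpow_const (.inl hr.ne')).mul hcut).deriv]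
      linear_combination (-β * annularCutoff ε r) * hrpow
    have hβ : |-β * annularCutoff ε r| ≤ |β| := by
      rw [abs_mul, abs_neg, abs_of_nonneg (annularCutoff_nonneg ε r)]
      exact mul_le_of_le_one_right (abs_nonneg β) (annularCutoff_le_one ε r)
    rw [hderiv, abs_mul, abs_of_pos (Real.rpow_pos_of_pos hr _)]
    gcongr
    exact (abs_add_le _ _).trans (add_le_add hβ (hM ε r hε))

end Cutoff

section WeightedEnergy

variable {m : ℕ} {α D a ρ r : ℝ} {f G v η : ℝ → ℝ}

theorem pow_div_sq_mul_rpow_sq (m : ℕ) (α : ℝ) (hr : 0 < r) :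
    r ^ m / r ^ 2 * (r ^ (-((m - 2 + α) / 2))) ^ 2 = r ^ (-α) := by
  rw [← Real.rpow_natCast r m, ← Real.rpow_natCast r 2, ← Real.rpow_natCast (r ^ _) 2,
    ← Real.rpow_mul hr.le, ← Real.rpow_sub hr, ← Real.rpow_add hr]
  congr 1
  push_cast
  ring

theorem integrableOn_rpow_neg (hα : α < 1) : IntegrableOn (fun r : ℝ => r ^ (-α)) (Ioo 0 2) :=
  (intervalIntegrable_iff_integrableOn_Ioo_of_le two_pos.le).1
    (intervalIntegral.intervalIntegrable_rpow' (by linarith))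

theorem pow_mul_deriv_flux_mul_le (hr : 0 < r) (x y : ℝ)
    (hy : |r * y| ≤ D * r ^ (-((m - 2 + α) / 2))) :
    r ^ m * (deriv flux x * x ^ 2) * y ^ 2 ≤ D ^ 2 * r ^ (-α) :=
  calc r ^ m * (deriv flux x * x ^ 2) * y ^ 2
      = r ^ m / r ^ 2 * ((deriv flux x * x ^ 2) * |r * y| ^ 2) := by
        rw [sq_abs]
        field_simp
    _ ≤ r ^ m / r ^ 2 * (1 * (D * r ^ (-((m - 2 + α) / 2))) ^ 2) := by
        gcongr
        exact deriv_flux_mul_sq_le_one x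
    _ = D ^ 2 * r ^ (-α) := by
        rw [← pow_div_sq_mul_rpow_sq m α hr]
        ring

theorem integral_pow_mul_deriv_flux_mul_le (hα : α < 1) (hη : tsupport η ⊆ Ioo 0 2)
    (hD : ∀ r, 0 < r → |r * deriv η r| ≤ D * r ^ (-((m - 2 + α) / 2))) :
    ∫ r, r ^ m * (deriv flux (v r) * v r ^ 2) * deriv η r ^ 2
      ≤ D ^ 2 * ∫ r in Ioo 0 2, r ^ (-α) := by
  have hsupp : ∀ r ∉ Ioo (0 : ℝ) 2,
      r ^ m * (deriv flux (v r) * v r ^ 2) * deriv η r ^ 2 = 0 := fun r hr => by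
    rw [image_eq_zero_of_notMem_tsupport fun h => hr (hη (tsupport_deriv_subset h)),
      zero_pow two_ne_zero, mul_zero]
  rw [← setIntegral_eq_integral_of_forall_compl_eq_zero hsupp, ← integral_const_mul]
  refine integral_mono_of_nonneg ?_ ((integrableOn_rpow_neg hα).const_mul _) ?_
  all_goals
    rw [EventuallyLE, ae_restrict_iff' measurableSet_Ioo]
    refine ae_of_all _ fun r hr => ?_
  · have := hr.1
    have := deriv_flux_nonneg (v r)
    simp only [Pi.zero_apply]
    positivity
  · exact pow_mul_deriv_flux_mul_le hr.1 _ _ (hD r hr.1)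

theorem IsStableProfile.integrable_pow_div_sq_mul {b : ℝ} (h : IsStableProfile m f a b G)
    (ha : 0 ≤ a) (hη : Continuous η) (hηc : HasCompactSupport η) (hηU : tsupport η ⊆ Ioo a b) :
    Integrable fun r => r ^ m / r ^ 2 * (flux (deriv G r) * deriv G r) * η r ^ 2 := by
  have hv := h.continuous_deriv
  refine integrable_mul_sq_of_tsupport_subset (U := Ioo a b) measurableSet_Ioo
    (ContinuousOn.mul (.div (by fun_prop) (by fun_prop) fun r hr => ?_)
      ((contDiff_flux.continuous.comp hv).mul hv).continuousOn) hη hηc hηU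
  exact pow_ne_zero 2 (ha.trans_lt hr.1).ne'

theorem IsStableProfile.exists_weighted_energy_bound (hm : 1 ≤ m) (hα : α < 1) :
    ∃ L : ℝ, 0 ≤ L ∧ ∀ {f G a}, IsStableProfile m f a (7 / 4) G → ContDiff ℝ 1 f → 0 < a →
      IntegrableOn (fun r => r ^ (-α) * (flux (deriv G r) * deriv G r)) (Ioo (4 * a) 1) ∧
      ∫ r in Ioo (4 * a) 1, r ^ (-α) * (flux (deriv G r) * deriv G r) ≤ L := by
  obtain ⟨D, hD⟩ := exists_truncated_rpow ((m - 2 + α) / 2)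
  refine ⟨D ^ 2 * ∫ r in Ioo 0 2, r ^ (-α), mul_nonneg (sq_nonneg D) <|
    setIntegral_nonneg measurableSet_Ioo fun r hr => Real.rpow_nonneg hr.1.le _,
    fun {f G a} h hf ha => ?_⟩
  obtain ⟨η, hη, hηsupp, hηeq, hηD⟩ := hD (2 * a) (by linarith)
  have hηU : tsupport η ⊆ Ioo a (7 / 4) := hηsupp.trans (Icc_subset_Ioo (by linarith) (by norm_num))
  have hηc : HasCompactSupport η := isCompact_Icc.of_isClosed_subset (isClosed_tsupport η) hηsupp
  set v := deriv G
  set e : ℝ → ℝ := fun r => r ^ m / r ^ 2 * (flux (v r) * v r) * η r ^ 2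
  have he : Integrable e := h.integrable_pow_div_sq_mul ha.le hη.continuous hηc hηU
  have he0 : ∀ r, 0 ≤ e r := fun r => by
    have := flux_mul_self_nonneg (v r)
    by_cases hr : r ∈ tsupport η
    · have : 0 < r := ha.trans (hηU hr).1
      positivity
    · simp [e, image_eq_zero_of_notMem_tsupport hr]
  have heq : EqOn e (fun r => r ^ (-α) * (flux (v r) * v r)) (Ioo (4 * a) 1) := fun r hr => by
    have hr0 : 0 < r := by linarith [hr.1]
    simp only [e]
    rw [hηeq r ⟨by linarith [hr.1], hr.2.le⟩, ← pow_div_sq_mul_rpow_sq m α hr0]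
    ring
  refine ⟨he.integrableOn.congr_fun heq measurableSet_Ioo, ?_⟩
  calc ∫ r in Ioo (4 * a) 1, r ^ (-α) * (flux (v r) * v r)
      = ∫ r in Ioo (4 * a) 1, e r := (setIntegral_congr_fun measurableSet_Ioo heq).symm
    _ ≤ ∫ r, e r := setIntegral_le_integral he (ae_of_all _ he0)
    _ ≤ m * ∫ r, e r := le_mul_of_one_le_left (integral_nonneg he0) (by exact_mod_cast hm)
    _ ≤ ∫ r, r ^ m * (deriv flux (v r) * v r ^ 2) * deriv η r ^ 2 :=
        h.mul_integral_le hf ha.le hη hηc hηU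
    _ ≤ D ^ 2 * ∫ r in Ioo 0 2, r ^ (-α) := integral_pow_mul_deriv_flux_mul_le hα
        (hηU.trans (Ioo_subset_Ioo ha.le (by norm_num))) hηD

theorem pow_mul_abs_le (hα : 0 ≤ α) (hr : 0 < r) (hrρ : r ≤ ρ) (x : ℝ) :
    r ^ m * |x| ≤ ρ ^ m + 2 * ρ ^ (m + α : ℝ) * (r ^ (-α) * (flux x * x)) := by
  have hflux := flux_mul_self_nonneg x
  calc r ^ m * |x| ≤ r ^ m * (1 + 2 * (flux x * x)) := by
        gcongr
        exact abs_le_one_add_two_mul_flux_mul x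
    _ = r ^ m + 2 * r ^ (m + α : ℝ) * (r ^ (-α) * (flux x * x)) := by
        rw [Real.rpow_add hr, Real.rpow_natCast, Real.rpow_neg hr.le]
        have := Real.rpow_pos_of_pos hr α
        field_simp
    _ ≤ _ := by gcongr

theorem IsStableProfile.exists_setIntegral_bound (hm : 1 ≤ m) (hα0 : 0 ≤ α) (hα1 : α < 1) :
    ∃ K : ℝ, 0 < K ∧ ∀ {f G a}, IsStableProfile m f a (7 / 4) G → ContDiff ℝ 1 f → 0 < a →
      ∀ ρ, 0 < ρ → ρ ≤ 1 → ∫ r in Ioo (4 * a) ρ, r ^ m * |deriv G r| ≤ K * ρ ^ (m + α : ℝ) := by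
  obtain ⟨L, hL, hbound⟩ := exists_weighted_energy_bound hm hα1
  refine ⟨1 + 2 * L, by positivity, fun {f G a} h hf ha ρ hρ hρ1 => ?_⟩
  obtain ⟨hint, hle⟩ := hbound h hf ha
  set e : ℝ → ℝ := fun r => r ^ (-α) * (flux (deriv G r) * deriv G r)
  have hsub : Ioo (4 * a) ρ ⊆ Ioo (4 * a) 1 := Ioo_subset_Ioo_right hρ1
  have hone : IntegrableOn (fun _ : ℝ => ρ ^ m) (Ioo (4 * a) ρ) := integrableOn_const (by simp)
  have he := (hint.mono_set hsub).const_mul (2 * ρ ^ (m + α : ℝ))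
  have hpos : ∀ r ∈ Ioo (4 * a) 1, 0 < r := fun r hr => by linarith [hr.1]
  have hlen : volume.real (Ioo (4 * a) ρ) * ρ ^ m ≤ ρ ^ (m + α : ℝ) :=
    calc volume.real (Ioo (4 * a) ρ) * ρ ^ m ≤ ρ * ρ ^ m := by
          gcongr
          rw [Real.volume_real_Ioo]
          exact max_le (by linarith) hρ.le
      _ = ρ ^ (m + 1 : ℝ) := by rw [Real.rpow_add_one hρ.ne', Real.rpow_natCast, mul_comm]
      _ ≤ ρ ^ (m + α : ℝ) := Real.rpow_le_rpow_of_exponent_ge hρ hρ1 (by linarith)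
  have hmono : ∫ r in Ioo (4 * a) ρ, e r ≤ L :=
    (setIntegral_mono_set hint ((ae_restrict_iff' measurableSet_Ioo).2 <| ae_of_all _ fun r hr =>
      mul_nonneg (Real.rpow_nonneg (hpos r hr).le _) (flux_mul_self_nonneg _))
        hsub.eventuallyLE).trans hle
  calc ∫ r in Ioo (4 * a) ρ, r ^ m * |deriv G r|
      ≤ ∫ r in Ioo (4 * a) ρ, (ρ ^ m + 2 * ρ ^ (m + α : ℝ) * e r) := by
        refine setIntegral_mono_on (Continuous.integrableOn_Icc ((continuous_pow m).mul
          h.continuous_deriv.abs) |>.mono_set Ioo_subset_Icc_self) (hone.add he)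
          measurableSet_Ioo fun r hr => ?_
        exact pow_mul_abs_le hα0 (hpos r (hsub hr)) hr.2.le _
    _ = volume.real (Ioo (4 * a) ρ) * ρ ^ m
          + 2 * ρ ^ (m + α : ℝ) * ∫ r in Ioo (4 * a) ρ, e r := by
        rw [integral_add hone he, setIntegral_const, integral_const_mul, smul_eq_mul]
    _ ≤ ρ ^ (m + α : ℝ) + 2 * ρ ^ (m + α : ℝ) * L := by gcongr
    _ = (1 + 2 * L) * ρ ^ (m + α : ℝ) := by ring

end WeightedEnergy

section Exhaustion

theorem iUnion_annulus {E : Type*} [NormedAddCommGroup E] (ρ : ℝ) :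
    ⋃ k : ℕ, norm ⁻¹' Ioo (1 / (k + 1 : ℝ)) ρ = Metric.ball (0 : E) ρ \ {0} := by
  ext x
  simp only [mem_iUnion, mem_preimage, mem_Ioo, Set.mem_sdiff, mem_ball_zero_iff, mem_singleton_iff]
  constructor
  · rintro ⟨k, hk, hxρ⟩
    exact ⟨hxρ, norm_pos_iff.1 (Nat.one_div_pos_of_nat.trans hk)⟩
  · rintro ⟨hxρ, hx0⟩
    exact (exists_nat_one_div_lt (norm_pos_iff.2 hx0)).imp fun _ hk => ⟨hk, hxρ⟩

theorem setIntegral_ball_le_of_eventually_annulus_le {E : Type*} [NormedAddCommGroup E]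
    [MeasurableSpace E] [OpensMeasurableSpace E] {μ : Measure E} [NullSingletonClass μ]
    {g : E → ℝ} {ρ C : ℝ}
    (hg : IntegrableOn g (Metric.ball 0 ρ) μ)
    (hC : ∀ᶠ δ in 𝓝[>] 0, ∫ x in norm ⁻¹' Ioo δ ρ, g x ∂μ ≤ C) :
    ∫ x in Metric.ball 0 ρ, g x ∂μ ≤ C := by
  have hmono : Monotone fun k : ℕ => (norm : E → ℝ) ⁻¹' Ioo (1 / (k + 1 : ℝ)) ρ :=
    fun _ _ hij => preimage_mono (Ioo_subset_Ioo_left (Nat.one_div_le_one_div hij))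
  have hlim := tendsto_setIntegral_of_monotone (μ := μ) (f := g)
    (fun _ => measurable_norm measurableSet_Ioo) hmono
    (iUnion_annulus (E := E) ρ ▸ hg.mono_set sdiff_subset)
  rw [iUnion_annulus, setIntegral_congr_set (sdiff_null_ae_eq_self (measure_singleton 0))] at hlim
  have hδ : Tendsto (fun k : ℕ => 1 / (k + 1 : ℝ)) atTop (𝓝[>] 0) :=
    tendsto_nhdsWithin_iff.2 ⟨tendsto_one_div_add_atTop_nhds_zero_nat,
      Eventually.of_forall fun _ => mem_Ioi.2 Nat.one_div_pos_of_nat⟩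
  exact le_of_tendsto hlim (hδ.eventually hC)

end Exhaustion

theorem setIntegral_annulus_norm_eq {n : ℕ} [NeZero n] {a b : ℝ} {v : ℝ → ℝ}
    {Du : EuclideanSpace ℝ (Fin n) → EuclideanSpace ℝ (Fin n)} (ha : 0 ≤ a)
    (hDu : ∀ᵐ x, ‖x‖ ∈ Ioo a b → Du x = (v ‖x‖ * ‖x‖⁻¹) • x) :
    ∫ x in norm ⁻¹' Ioo a b, ‖Du x‖ =
      sphereArea n * ∫ r in Ioo a b, r ^ (n - 1) * |v r| := by
  have hnorm : ∀ᵐ x, (norm ⁻¹' Ioo a b).indicator (fun x => ‖Du x‖) x =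
      (Ioo a b).indicator (fun r => |v r|) ‖x‖ := by
    filter_upwards [hDu] with x hx
    by_cases hxab : ‖x‖ ∈ Ioo a b
    · rw [indicator_of_mem (mem_preimage.2 hxab), indicator_of_mem hxab, hx hxab,
        norm_radial (norm_pos_iff.1 (ha.trans_lt hxab.1))]
    · rw [indicator_of_notMem (mt mem_preimage.1 hxab), indicator_of_notMem hxab]
  rw [← integral_indicator (measurable_norm measurableSet_Ioo), ← setIntegral_univ,
    setIntegral_eq_sphereArea_mul ha (subset_univ _) (fun r hr => indicator_of_notMem hr _) hnorm,
    ← integral_indicator measurableSet_Ioo]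
  simp only [indicator_mul_right]

theorem IsStableSolution.exists_setIntegral_norm_bound {n : ℕ} (hn : 2 ≤ n) {α : ℝ} (hα0 : 0 ≤ α)
    (hα1 : α < 1) :
    ∃ K, 0 < K ∧ ∀ {f u} {Du : EuclideanSpace ℝ (Fin n) → EuclideanSpace ℝ (Fin n)},
      ContDiff ℝ 1 f → MemSobolevLoc (Metric.ball 0 2) 2 u →
      IsStableSolution f (Metric.ball 0 2) u Du → IsRadialOn (Metric.ball 0 2) u →
      ∀ ρ δ, ρ ≤ 1 → 0 < δ → δ < ρ →
        ∫ x in norm ⁻¹' Ioo δ ρ, ‖Du x‖ ≤ K * ρ ^ (n - 1 + α : ℝ) := by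
  have : NeZero n := ⟨by omega⟩
  obtain ⟨K, hK, hbound⟩ := IsStableProfile.exists_setIntegral_bound
    (Nat.le_sub_one_of_lt hn) hα0 hα1
  refine ⟨sphereArea n * K, mul_pos sphereArea_pos hK,
    fun {f u Du} hf hu2 hu hrad ρ δ hρ hδ hδρ => ?_⟩
  have hball : norm ⁻¹' Icc (δ / 4) (7 / 4) ⊆ Metric.ball (0 : EuclideanSpace ℝ (Fin n)) 2 :=
    fun x hx => mem_ball_zero_iff.2 (hx.2.trans_lt (by norm_num))
  obtain ⟨G, hG, hDu⟩ := hu.exists_isStableProfile hu2 hrad (by positivity) (by linarith) hball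
  have hDuδ : ∀ᵐ x, ‖x‖ ∈ Ioo δ ρ → Du x = (deriv G ‖x‖ * ‖x‖⁻¹) • x :=
    hDu.mono fun x hx hxδ => hx (Ioo_subset_Ioo (by linarith) (by linarith) hxδ)
  have hGδ := hbound hG hf (by positivity) ρ (hδ.trans hδρ) hρ
  rw [mul_div_cancel₀ δ four_ne_zero, Nat.cast_pred (by omega)] at hGδ
  rw [setIntegral_annulus_norm_eq hδ.le hDuδ, mul_assoc]
  exact mul_le_mul_of_nonneg_left hGδ sphereArea_pos.le

end MeanCurvature

theorem proposition1p4_general (n : ℕ) (hn : 2 ≤ n) (α : ℝ) (hα1 : α < 1) :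
    ∃ K : ℝ, 0 < K ∧
      ∀ (f : ℝ → ℝ) (u : EuclideanSpace ℝ (Fin n) → ℝ)
        (Du : EuclideanSpace ℝ (Fin n) → EuclideanSpace ℝ (Fin n)),
        ContDiff ℝ 1 f →
        MeanCurvature.MemSobolevLoc (Metric.ball 0 2) 2 u →
        MeanCurvature.IsStableSolution f (Metric.ball 0 2) u Du →
        MeanCurvature.IsRadialOn (Metric.ball 0 2) u →
        ∀ ρ : ℝ, 0 < ρ → ρ < 1 →
          IntegrableOn Du (Metric.ball 0 ρ) volume ∧
          ∫ x in Metric.ball 0 ρ, ‖Du x‖ ≤ K * ρ ^ ((n : ℝ) - 1 + α) := by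
  have : NeZero n := ⟨by omega⟩
  obtain ⟨K, hK, hbound⟩ := MeanCurvature.IsStableSolution.exists_setIntegral_norm_bound hn
    (le_max_right α 0) (max_lt hα1 one_pos)
  refine ⟨K, hK, fun f u Du hf hu2 hu hrad ρ hρ hρ1 => ?_⟩
  have hint : IntegrableOn Du (Metric.ball 0 ρ) :=
    (hu.weakGradient.locInt_grad.integrableOn_compact_subset
      (Metric.closedBall_subset_ball (by linarith)) (isCompact_closedBall 0 ρ)).mono_set
      Metric.ball_subset_closedBall
  refine ⟨hint, MeanCurvature.setIntegral_ball_le_of_eventually_annulus_le hint.norm ?_⟩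
  filter_upwards [Ioo_mem_nhdsGT hρ] with δ hδ
  calc ∫ x in norm ⁻¹' Set.Ioo δ ρ, ‖Du x‖
      ≤ K * ρ ^ (n - 1 + max α 0 : ℝ) := hbound hf hu2 hu hrad ρ δ hρ1.le hδ.1 hδ.2
    _ ≤ K * ρ ^ (n - 1 + α : ℝ) := by
        gcongr ?_ * ?_
        exact Real.rpow_le_rpow_of_exponent_ge hρ hρ1.le (by linarith [le_max_left α 0])

theorem proposition1p4 (n : ℕ) (hn : 2 ≤ n) (α : ℝ) (hα0 : 0 < α) (hα1 : α < 1) :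
    ∃ K : ℝ, 0 < K ∧
      ∀ (f : ℝ → ℝ) (u : EuclideanSpace ℝ (Fin n) → ℝ)
        (Du : EuclideanSpace ℝ (Fin n) → EuclideanSpace ℝ (Fin n)),
        ContDiff ℝ 1 f →
        MeanCurvature.MemSobolevLoc (Metric.ball 0 2) 3 u →
        MeanCurvature.IsStableSolution f (Metric.ball 0 2) u Du →
        MeanCurvature.IsRadialOn (Metric.ball 0 2) u →
        ∀ ρ : ℝ, 0 < ρ → ρ < 1 →
          IntegrableOn Du (Metric.ball 0 ρ) volume ∧
          ∫ x in Metric.ball 0 ρ, ‖Du x‖ ≤ K * ρ ^ ((n : ℝ) - 1 + α) := by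
  obtain ⟨K, hK, hbound⟩ := proposition1p4_general n hn α hα1
  exact ⟨K, hK, fun f u Du hf hu => hbound f u Du hf hu.of_succ⟩
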